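/- Let $\mathbb N=\{0,1,2,\dots\}$ and $[n]=\{1,\dots,n\}$. For $m,n\in\mathbb N$ let $\mathcal P_{mn}$ be the set of all set partitions of $[m]\cup[n]'$, where $[n]'=\{1',\dots,n'\}$ is a disjoint copy of $[n]$; for $\alpha\in\mathcal P_{mn}$ write $\mathbf d(\alpha)=m$ and $\mathbf r(\alpha)=n$. For $\alpha\in\mathcal P_{mn}$ and $\beta\in\mathcal P_{nk}$ the product $\alpha\beta\in\mathcal P_{mk}$ is defined as follows: replace each $x'$ in $\alpha$ and each $x$ in $\beta$ ($x\in[n]$) by $x''$, form the graph on $[m]\cup[n]''\cup[k]'$ in which two vertices are adjacent if they lie in a common block of (the relabelled) $\alpha$ or $\beta$, and let two elements of $[m]\cup[k]'$ be in the same block of $\alpha\beta$ iff they are in the same connected component of this graph. This makes $\mathcal P=\bigcup_{m,n}\mathcal P_{mn}$ a category with object set $\mathbb N$ (the partition category). A block is a transversal if it meets both $[m]$ and $[n]'$, an upper nontransversal if it is contained in $[m]$, and a lower nontransversal if it is contained in $[n]'$. A partition is planar if it can be drawn without crossings in a rectangle with $1,\dots,m$ in order on the top side and $1',\dots,n'$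 in order on the bottom side; equivalently, if it is non-crossing for the boundary order $1,\dots,m,n',\dots,1'$. Let $\mathcal{PB}$, $\mathcal B$, $\mathcal{PP}$ be the subcategories of $\mathcal P$ of all partitions that, respectively, have all blocks of size $1$ or $2$, have all blocks of size $2$, are planar; and let $\mathcal M=\mathcal{PB}\cap\mathcal{PP}$ and $\mathcal{TL}=\mathcal B\cap\mathcal{PP}$. For $\alpha\in\mathcal P_{mn}$ let $\operatorname{dom}(\alpha)=\{x\in[m]: x\text{ is in a transversal}\}$, $\operatorname{codom}(\alpha)=\{x\in[n]: x'\text{ is in a transversal}\}$, $\ker(\alpha)=\{(x,y)\in[m]^2: x,y\text{ are in the same block}\}$, $\operatorname{coker}(\alpha)=\{(x,y)\in[n]^2: x',y'\text{ are in the same block}\}$; let $N_U(\alpha)$ and $N_L(\alpha)$ be the sets of upper and lower nontransversals, and let $\operatorname{rank}(\alpha)$ be the number of transversals. In a category $\mathcal K$, write $\alpha\le_{\mathscr R}\beta$, $\alpha\le_{\mathscr L}\beta$, $\alpha\le_{\mathscr J}\beta$ if, respectively, $\alpha=\beta\gamma$, $\alpha=\gamma\beta$, $\alpha=\gamma\beta\delta$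 for some morphisms $\gamma,\delta$ of $\mathcal K$; let $\mathscr R,\mathscr L,\mathscr J$ be the equivalences ${\le}\cap{\ge}$ of these preorders and $\mathscr D$ the least equivalence containing $\mathscr R\cup\mathscr L$. **Theorem.** Let $\mathcal K$ be any of $\mathcal P,\mathcal{PB},\mathcal B,\mathcal{PP},\mathcal M,\mathcal{TL}$, and let $\alpha,\beta\in\mathcal K$. Then in $\mathcal K$: 1. $\alpha\le_{\mathscr R}\beta$ iff $\mathbf d(\alpha)=\mathbf d(\beta)$, $\ker(\alpha)\supseteq\ker(\beta)$ and $N_U(\alpha)\supseteq N_U(\beta)$. 2. $\alpha\le_{\mathscr L}\beta$ iff $\mathbf r(\alpha)=\mathbf r(\beta)$, $\operatorname{coker}(\alpha)\supseteq\operatorname{coker}(\beta)$ and $N_L(\alpha)\supseteq N_L(\beta)$. 3. If $\mathcal K$ is not $\mathcal B$ or $\mathcal{TL}$, then $\alpha\le_{\mathscr J}\beta$ iff $\operatorname{rank}(\alpha)\le\operatorname{rank}(\beta)$. If $\mathcal K$ is $\mathcal B$ or $\mathcal{TL}$, then $\alpha\le_{\mathscr J}\beta$ iff $\operatorname{rank}(\alpha)\le\operatorname{rank}(\beta)$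 and $\operatorname{rank}(\alpha)\equiv\operatorname{rank}(\beta)\pmod 2$. 4. $\alpha\mathrel{\mathscr R}\beta$ iff $\ker(\alpha)=\ker(\beta)$ and $N_U(\alpha)=N_U(\beta)$, iff $\operatorname{dom}(\alpha)=\operatorname{dom}(\beta)$ and $\ker(\alpha)=\ker(\beta)$. 5. $\alpha\mathrel{\mathscr L}\beta$ iff $\operatorname{coker}(\alpha)=\operatorname{coker}(\beta)$ and $N_L(\alpha)=N_L(\beta)$, iff $\operatorname{codom}(\alpha)=\operatorname{codom}(\beta)$ and $\operatorname{coker}(\alpha)=\operatorname{coker}(\beta)$. 6. $\alpha\mathrel{\mathscr J}\beta$ iff $\alpha\mathrel{\mathscr D}\beta$, iff $\operatorname{rank}(\alpha)=\operatorname{rank}(\beta)$. -/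

import Mathlib

namespace DiagramCategories

/-- The vertex set `[m] ∪ [n]'`: the upper vertices `[m]` are `Sum.inl`, the lower vertices `[n]'`
are `Sum.inr`. The labels `1, …, m` are modelled by `Fin m`, hence shifted down by one. -/
abbrev Vertex (m n : ℕ) : Type := Fin m ⊕ Fin n

/-- An element of the partition category `𝒫 = ⋃ 𝒫ₘₙ`: a set partition (given by its equivalence
relation "same block") of `[src] ∪ [tgt]'`, where `src = d(α)` and `tgt = r(α)`. -/
structure Diagram where
  src : ℕ
  tgt : ℕ
  rel : Setoid (Vertex src tgt)

namespace Diagram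

/-- The blocks of a partition. -/
def blocks (α : Diagram) : Set (Set (Vertex α.src α.tgt)) := α.rel.classes

/-- The edges of the product graph `Π(α, β)` on `[m] ∪ [n]'' ∪ [k]'`, where `m = d(α)`,
`n = r(α) = d(β)`, `k = r(β)`. Each block of `α` and of `β` is drawn as a complete graph. The
lower vertices of `α` and the upper vertices of `β` are both identified with the middle row. -/
inductive ProductEdge (α β : Diagram) (h : α.tgt = β.src) :
    Fin α.src ⊕ (Fin α.tgt ⊕ Fin β.tgt) → Fin α.src ⊕ (Fin α.tgt ⊕ Fin β.tgt) → Prop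
  | top (x y : Vertex α.src α.tgt) : α.rel x y →
      ProductEdge α β h (Sum.map id Sum.inl x) (Sum.map id Sum.inl y)
  | bot (x y : Vertex β.src β.tgt) : β.rel x y →
      ProductEdge α β h (Sum.inr (Sum.map (Fin.cast h.symm) id x))
        (Sum.inr (Sum.map (Fin.cast h.symm) id y))

/-- The product `αβ`, defined exactly when `r(α) = d(β)`: two vertices of `[m] ∪ [k]'` are in the
same block iff they are in the same connected component of the product graph. -/
def mul (α β : Diagram) (h : α.tgt = β.src) : Diagram where
  src := α.src
  tgt := β.tgt
  rel := (Relation.EqvGen.setoid (ProductEdge α β h)).comap (Sum.map id Sum.inr)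

/-- A transversal: a block meeting both rows. -/
def IsTransversal {m n : ℕ} (X : Set (Vertex m n)) : Prop :=
  (∃ i : Fin m, Sum.inl i ∈ X) ∧ ∃ j : Fin n, Sum.inr j ∈ X

/-- `dom(α)`: the upper vertices that belong to a transversal. -/
def dom (α : Diagram) : Set ℕ :=
  {x | ∃ i : Fin α.src, x = i ∧ ∃ X ∈ α.blocks, IsTransversal X ∧ Sum.inl i ∈ X}

/-- `codom(α)`: the labels of lower vertices that belong to a transversal. -/
def codom (α : Diagram) : Set ℕ :=
  {x | ∃ j : Fin α.tgt, x = j ∧ ∃ X ∈ α.blocks, IsTransversal X ∧ Sum.inr j ∈ X}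

/-- `ker(α)`: the equivalence relation "same block" on `[m]`, as a set of pairs. -/
def ker (α : Diagram) : Set (ℕ × ℕ) :=
  {p | ∃ i j : Fin α.src, p = ((i : ℕ), (j : ℕ)) ∧ α.rel (Sum.inl i) (Sum.inl j)}

/-- `coker(α)`: the equivalence relation "same block" on `[n]`, as a set of pairs. -/
def coker (α : Diagram) : Set (ℕ × ℕ) :=
  {p | ∃ i j : Fin α.tgt, p = ((i : ℕ), (j : ℕ)) ∧ α.rel (Sum.inr i) (Sum.inr j)}

/-- `N_U(α)`: the set of upper nontransversals, i.e. blocks contained in the upper row. -/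
def upperNontransversals (α : Diagram) : Set (Set ℕ) :=
  {A | ∃ X ∈ α.blocks, (∀ j : Fin α.tgt, Sum.inr j ∉ X) ∧
    A = {x : ℕ | ∃ i : Fin α.src, x = i ∧ Sum.inl i ∈ X}}

/-- `N_L(α)`: the set of lower nontransversals, i.e. blocks contained in the lower row
(with primes removed). -/
def lowerNontransversals (α : Diagram) : Set (Set ℕ) :=
  {A | ∃ X ∈ α.blocks, (∀ i : Fin α.src, Sum.inl i ∉ X) ∧
    A = {x : ℕ | ∃ j : Fin α.tgt, x = j ∧ Sum.inr j ∈ X}}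

/-- `rank(α)`: the number of transversals. -/
noncomputable def rank (α : Diagram) : ℕ := {X ∈ α.blocks | IsTransversal X}.ncard

/-- Every block has size `1` or `2`. -/
def IsPartialBrauer (α : Diagram) : Prop := ∀ X ∈ α.blocks, X.ncard = 1 ∨ X.ncard = 2

/-- Every block has size `2`. -/
def IsBrauer (α : Diagram) : Prop := ∀ X ∈ α.blocks, X.ncard = 2

/-- The position of a vertex when one walks around the boundary of the rectangle in which diagrams
are drawn: `1, 2, …, m` along the top row, then `n', …, 2', 1'` back along the bottom row. -/
def boundaryPos {m n : ℕ} : Vertex m n → ℕ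
  | Sum.inl i => i
  | Sum.inr j => m + Fin.rev j

/-- A partition is planar if it can be drawn in the rectangle without crossings, i.e. if it is
non-crossing for the order of the vertices around the boundary of the rectangle: no two vertices
`w`, `y` of one block separate two vertices `x`, `z` of another block. -/
def IsPlanar (α : Diagram) : Prop :=
  ∀ w x y z : Vertex α.src α.tgt,
    boundaryPos w < boundaryPos x → boundaryPos x < boundaryPos y → boundaryPos y < boundaryPos z →
    α.rel w y → α.rel x z → α.rel w x

end Diagram

open Diagram

/-- Names of the six diagram categories: partition, partial Brauer, Brauer, planar partition,
Motzkin, Temperley-Lieb. -/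
inductive Kind where
  | P
  | PB
  | B
  | PP
  | M
  | TL

/-- The set of all morphisms of each of the six categories, as a subset of `𝒫`. -/
def Kind.morphisms : Kind → Set Diagram
  | .P => Set.univ
  | .PB => {α | α.IsPartialBrauer}
  | .B => {α | α.IsBrauer}
  | .PP => {α | α.IsPlanar}
  | .M => {α | α.IsPartialBrauer ∧ α.IsPlanar}
  | .TL => {α | α.IsBrauer ∧ α.IsPlanar}

section Green

/-! Green's preorders and relations on a subcategory of `𝒫` with set of morphisms `S`; the
multipliers range over `S`, which contains the identities. -/

/-- `α ≤_ℛ β` in `S`: `α = βγ` for some `γ ∈ S`. -/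
def LeR {S : Set Diagram} (α β : S) : Prop :=
  ∃ γ : S, ∃ h : β.1.tgt = γ.1.src, α.1 = β.1.mul γ.1 h

/-- `α ≤_ℒ β` in `S`: `α = γβ` for some `γ ∈ S`. -/
def LeL {S : Set Diagram} (α β : S) : Prop :=
  ∃ γ : S, ∃ h : γ.1.tgt = β.1.src, α.1 = γ.1.mul β.1 h

/-- `α ≤_𝒥 β` in `S`: `α = γβδ` for some `γ, δ ∈ S`. -/
def LeJ {S : Set Diagram} (α β : S) : Prop :=
  ∃ γ δ : S, ∃ (h₁ : γ.1.tgt = β.1.src) (h₂ : (γ.1.mul β.1 h₁).tgt = δ.1.src),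
    α.1 = (γ.1.mul β.1 h₁).mul δ.1 h₂

/-- Green's relation `ℛ`. -/
def GreenR {S : Set Diagram} (α β : S) : Prop := LeR α β ∧ LeR β α

/-- Green's relation `ℒ`. -/
def GreenL {S : Set Diagram} (α β : S) : Prop := LeL α β ∧ LeL β α

/-- Green's relation `𝒥`. -/
def GreenJ {S : Set Diagram} (α β : S) : Prop := LeJ α β ∧ LeJ β α

/-- Green's relation `𝒟`: the least equivalence relation on `S` containing `ℛ` and `ℒ`. -/
def GreenD {S : Set Diagram} : S → S → Prop :=
  Relation.EqvGen fun α β => GreenR α β ∨ GreenL α β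

end Green

end DiagramCategories

/-! Write `s*` for the reflection of `s` in a horizontal line. The condition `UpperLe r s` says that
the kernel of `r` contains that of `s` and that the upper nontransversals of `s` are blocks of `r`.
It is necessary for `r = s t`, since multiplying on the right can only merge blocks of `s` that
reach the middle row. It is also sufficient, because it gives `r = s (s* r)` (`comp_flip_comp`). The
multiplier `s* r` lies in the same category as soon as that category is closed under reflection and
products, so one argument serves all six, and reflection turns the statements on `ℛ` into those on
`ℒ`.

The real content is thus closure under products. For blocks of size at most two it is a degree count
in the product graph (`atMostPairs_comp`), the absence of singletons is a parity count
(`noSingletons_comp`), and planarity is a discrete Jordan curve argument modulo two (`exists_sides`,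
`planar_comp`).

For `𝒥` and `𝒟`, cut each transversal of `α` and tie it to a single lower vertex, in order of least
upper vertices. This upper half is `ℛ`-related to `α` and has exactly `rank α` lower vertices, all
in distinct transversals. Upper halves with equally many lower vertices are `ℒ`-related, so equal
rank gives `𝒟`. An upper half of `α` and a lower half of `β` are linked by a full partition from
`rank α` to `rank β`. It exists when `rank α ≤ rank β`, with equal parity in the Brauer cases
(`leJ_of_full`). Conversely products do not raise the rank, and in Brauer diagrams the rank has the
parity of each row. -/

namespace DiagramCategories

open Diagram

/-! ### Connectivity in the product graph -/

section Product

variable {m n k : ℕ}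

/-- Connectivity in the product graph of two set partitions. -/
def conn (r : Setoid (Vertex m n)) (s : Setoid (Vertex n k)) :
    Setoid (Fin m ⊕ (Fin n ⊕ Fin k)) :=
  Relation.EqvGen.setoid (ProductEdge ⟨m, n, r⟩ ⟨n, k, s⟩ rfl)

/-- The product of two set partitions, as an equivalence relation. -/
def comp (r : Setoid (Vertex m n)) (s : Setoid (Vertex n k)) : Setoid (Vertex m k) :=
  (conn r s).comap (Sum.map id Sum.inr)

variable {r : Setoid (Vertex m n)} {s : Setoid (Vertex n k)}

theorem comp_iff {x y : Vertex m k} :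
    comp r s x y ↔ conn r s (Sum.map id Sum.inr x) (Sum.map id Sum.inr y) := Iff.rfl

theorem conn_left {x y : Vertex m n} (h : r x y) :
    conn r s (Sum.map id Sum.inl x) (Sum.map id Sum.inl y) :=
  Relation.EqvGen.rel _ _ (ProductEdge.top (α := ⟨m, n, r⟩) (β := ⟨n, k, s⟩) x y h)

theorem conn_right {x y : Vertex n k} (h : s x y) : conn r s (Sum.inr x) (Sum.inr y) := by
  have := Relation.EqvGen.rel _ _
    (ProductEdge.bot (α := ⟨m, n, r⟩) (β := ⟨n, k, s⟩) (h := rfl) x y h)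
  rcases x with x | x <;> rcases y with y | y <;> exact this

/-- Induction on connectedness in the product graph. -/
theorem conn_induction {p : Fin m ⊕ (Fin n ⊕ Fin k) → Fin m ⊕ (Fin n ⊕ Fin k) → Prop}
    (left : ∀ x y, r x y → p (Sum.map id Sum.inl x) (Sum.map id Sum.inl y))
    (right : ∀ x y, s x y → p (Sum.inr x) (Sum.inr y))
    (refl : ∀ x, p x x)
    (symm : ∀ x y, conn r s x y → p x y → p y x)
    (trans : ∀ x y z, conn r s x y → conn r s y z → p x y → p y z → p x z)
    {x y : Fin m ⊕ (Fin n ⊕ Fin k)} (h : conn r s x y) : p x y := by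
  refine Relation.EqvGen.rec (motive := fun x y _ => p x y) ?_ refl symm trans h
  rintro _ _ (⟨x, y, h⟩ | ⟨x, y, h⟩)
  · exact left x y h
  · simpa using right x y h

/-- A function that is constant along the edges of the product graph is constant on components. -/
theorem conn_const {X : Type*} (f : Fin m ⊕ (Fin n ⊕ Fin k) → X)
    (left : ∀ x y, r x y → f (Sum.map id Sum.inl x) = f (Sum.map id Sum.inl y))
    (right : ∀ x y, s x y → f (Sum.inr x) = f (Sum.inr y))
    {x y : Fin m ⊕ (Fin n ⊕ Fin k)} (h : conn r s x y) : f x = f y :=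
  conn_induction (p := fun x y => f x = f y) left right (fun _ => rfl)
    (fun _ _ _ h => h.symm) (fun _ _ _ _ _ h h' => h.trans h') h

end Product

/-! ### Kernels, upper nontransversals and reflection -/

section Upper

variable {m n k l : ℕ}

/-- The upper vertex `i` belongs to a transversal. -/
def InDom (r : Setoid (Vertex m n)) (i : Fin m) : Prop := ∃ j, r (Sum.inl i) (Sum.inr j)

/-- Each block of `s` in the upper row is a block of `r`, and the kernel of `r` contains that
of `s`. -/
def UpperLe (r : Setoid (Vertex m n)) (s : Setoid (Vertex m k)) : Prop :=
  (∀ i j, s (Sum.inl i) (Sum.inl j) → r (Sum.inl i) (Sum.inl j)) ∧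
    ∀ i, ¬ InDom s i → ¬ InDom r i ∧ ∀ j, r (Sum.inl i) (Sum.inl j) → s (Sum.inl i) (Sum.inl j)

theorem UpperLe.trans {r : Setoid (Vertex m n)} {s : Setoid (Vertex m k)} {t : Setoid (Vertex m l)}
    (h : UpperLe r s) (h' : UpperLe s t) : UpperLe r t :=
  ⟨fun i j hij => h.1 i j (h'.1 i j hij), fun i hi =>
    ⟨(h.2 i (h'.2 i hi).1).1, fun j hij => (h'.2 i hi).2 j ((h.2 i (h'.2 i hi).1).2 j hij)⟩⟩

/-- Two partitions with the same kernel and domain are below each other. -/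
theorem upperLe_of_eq {r : Setoid (Vertex m n)} {s : Setoid (Vertex m k)}
    (h : ∀ i j, r (Sum.inl i) (Sum.inl j) ↔ s (Sum.inl i) (Sum.inl j))
    (h' : ∀ i, InDom r i ↔ InDom s i) : UpperLe r s :=
  ⟨fun i j => (h i j).2, fun i hi => ⟨fun hr => hi ((h' i).1 hr), fun j => (h i j).1⟩⟩

/-- A block of `r` inside the upper row has no edge to the middle row, so it is already a component
of the product graph: its indicator function is constant along edges. -/
theorem upperLe_comp (r : Setoid (Vertex m n)) (s : Setoid (Vertex n k)) :
    UpperLe (comp r s) r := by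
  refine ⟨fun i j h => conn_left h, fun i hi => ?_⟩
  have key : ∀ v, conn r s (Sum.inl i) v →
      Sum.elim (fun j => r (Sum.inl i) (Sum.inl j)) (fun _ => False) v := by
    intro v hv
    have := conn_const (r := r) (s := s)
      (Sum.elim (fun j => r (Sum.inl i) (Sum.inl j)) (fun _ => False)) ?_ ?_ hv
    · rw [← this]
      exact r.refl _
    · rintro (x | x) (y | y) h
      · exact propext ⟨fun h' => r.trans h' h, fun h' => r.trans h' (r.symm h)⟩
      · simp only [Sum.map_inl, Sum.map_inr, Sum.elim_inl, Sum.elim_inr, eq_iff_iff, iff_false]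
        exact fun h' => hi ⟨y, r.trans h' h⟩
      · simp only [Sum.map_inl, Sum.map_inr, Sum.elim_inl, Sum.elim_inr, eq_iff_iff, false_iff]
        exact fun h' => hi ⟨x, r.trans h' (r.symm h)⟩
      · rfl
    · intros; rfl
  exact ⟨fun ⟨j, hj⟩ => key _ hj, fun j hj => key _ hj⟩

/-- The reflection of a set partition in a horizontal line. -/
def flip (r : Setoid (Vertex m n)) : Setoid (Vertex n m) := r.comap Sum.swap

theorem flip_iff {r : Setoid (Vertex m n)} {x y : Vertex n m} : flip r x y ↔ r x.swap y.swap :=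
  Iff.rfl

@[simp] theorem flip_flip (r : Setoid (Vertex m n)) : flip (flip r) = r := by
  ext x y
  simp [flip_iff]

open Classical in
/-- The colouring of the middle row by which products of the form `s (s* r)` are computed. -/
noncomputable def middleColour (r : Setoid (Vertex m n)) (s : Setoid (Vertex m k)) (l : Fin k) :
    Option (Quotient r) :=
  if h : ∃ x, s (Sum.inl x) (Sum.inr l) then some (Quotient.mk r (Sum.inl h.choose)) else none

section

variable {r : Setoid (Vertex m n)} {s : Setoid (Vertex m k)}

theorem middleColour_eq_some (hrs : UpperLe r s) {l : Fin k} {x : Fin m}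
    (h : s (Sum.inl x) (Sum.inr l)) : middleColour r s l = some (Quotient.mk r (Sum.inl x)) := by
  have h' : ∃ x, s (Sum.inl x) (Sum.inr l) := ⟨x, h⟩
  rw [middleColour, dif_pos h']
  exact congrArg some (Quotient.sound (hrs.1 _ _ (s.trans h'.choose_spec (s.symm h))))

theorem middleColour_congr (hrs : UpperLe r s) {l l' : Fin k} (h : s (Sum.inr l) (Sum.inr l')) :
    middleColour r s l = middleColour r s l' := by
  by_cases hl : ∃ x, s (Sum.inl x) (Sum.inr l)
  · obtain ⟨x, hx⟩ := hl
    rw [middleColour_eq_some hrs hx, middleColour_eq_some hrs (s.trans hx h)]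
  · have hl' : ¬ ∃ x, s (Sum.inl x) (Sum.inr l') := fun ⟨x, hx⟩ => hl ⟨x, s.trans hx (s.symm h)⟩
    rw [middleColour, middleColour, dif_neg hl, dif_neg hl']

/-- If `r` is below `s` then `r = s s* r`. -/
theorem comp_flip_comp (hrs : UpperLe r s) : comp s (comp (flip s) r) = r := by
  ext u v
  constructor
  · intro h
    -- Colour each outer vertex by its `r`-block, and a middle vertex by the `r`-block of any upper
    -- vertex that `s` joins to it, with `none` if there is no such vertex. Edges preserve colours,
    -- so the product joins no two blocks of `r`.
    have hcol : ∀ x y, s x y →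
        Sum.elim (fun i => some (Quotient.mk r (Sum.inl i))) (middleColour r s) x =
          Sum.elim (fun i => some (Quotient.mk r (Sum.inl i))) (middleColour r s) y := by
      rintro (x | x) (y | y) h
      · exact congrArg some (Quotient.sound (hrs.1 _ _ h))
      · exact (middleColour_eq_some hrs h).symm
      · exact middleColour_eq_some hrs (s.symm h)
      · exact middleColour_congr hrs h
    have key := conn_const (r := s) (s := comp (flip s) r)
      (Sum.elim (fun i => some (Quotient.mk r (Sum.inl i)))
        (Sum.elim (middleColour r s) fun i => some (Quotient.mk r (Sum.inr i)))) ?_ ?_ h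
    · have : some (Quotient.mk r u) = some (Quotient.mk r v) := by
        rcases u with u | u <;> rcases v with v | v <;> exact key
      exact Quotient.exact (Option.some.inj this)
    · rintro (x | x) (y | y) h <;> exact hcol _ _ h
    · intro x y hxy
      have key' := conn_const (r := flip s) (s := r)
        (Sum.elim (middleColour r s) fun x => some (Quotient.mk r x)) ?_ ?_ hxy
      · rcases x with x | x <;> rcases y with y | y <;> exact key'
      · rintro (x | x) (y | y) h <;> exact hcol _ _ h
      · exact fun x y h => congrArg some (Quotient.sound h)
  -- Conversely, an `r`-edge at `x` is recovered by going down to `l` along `s`, back up to `x`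
  -- along `s*`, and then along `r`. Where `s` has no such `l`, the blocks of `r` and `s` agree.
  · have mid : ∀ {x : Fin m} {l : Fin k} {v : Vertex m n}, s (Sum.inl x) (Sum.inr l) →
        r (Sum.inl x) v → conn (flip s) r (Sum.inl l) (Sum.inr v) := fun {x l v} h h' =>
      (conn (flip s) r).trans (conn_left (x := Sum.inl l) (y := Sum.inr x) (s.symm h))
        (conn_right h')
    have bot : ∀ {x : Fin m} {v : Fin n}, r (Sum.inl x) (Sum.inr v) →
        comp s (comp (flip s) r) (Sum.inl x) (Sum.inr v) := by
      intro x v h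
      by_cases hx : InDom s x
      · obtain ⟨l, hl⟩ := hx
        exact (conn _ _).trans (conn_left (x := Sum.inl x) (y := Sum.inr l) hl)
          (conn_right (x := Sum.inl l) (y := Sum.inr v) (mid hl h))
      · exact absurd ⟨v, h⟩ (hrs.2 x hx).1
    intro h
    rcases u with x | u <;> rcases v with y | v
    · by_cases hx : InDom s x
      · by_cases hy : InDom s y
        · obtain ⟨l, hl⟩ := hx
          obtain ⟨l', hl'⟩ := hy
          refine (conn _ _).trans (conn_left (x := Sum.inl x) (y := Sum.inr l) hl)
            ((conn _ _).trans (conn_right (x := Sum.inl l) (y := Sum.inl l') ?_)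
              (conn_left (x := Sum.inr l') (y := Sum.inl y) (s.symm hl')))
          exact (conn _ _).trans (mid hl h)
            (conn_left (x := Sum.inr y) (y := Sum.inl l') hl')
        · exact conn_left (s.symm ((hrs.2 y hy).2 x (r.symm h)))
      · exact conn_left ((hrs.2 x hx).2 y h)
    · exact bot h
    · exact (comp _ _).symm (bot (r.symm h))
    · exact conn_right (x := Sum.inr u) (y := Sum.inr v)
        (conn_right (x := Sum.inr u) (y := Sum.inr v) h)

end

/-- Reflection reverses products. -/
theorem flip_comp (r : Setoid (Vertex m n)) (s : Setoid (Vertex n k)) :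
    flip (comp r s) = comp (flip s) (flip r) := by
  -- Exchanging the outer rows and fixing the middle one maps one product graph to the other. Stated
  -- for arbitrary factors, this serves both directions.
  have key : ∀ {m n k : ℕ} (r : Setoid (Vertex m n)) (s : Setoid (Vertex n k)) (x y),
      conn r s x y → conn (flip s) (flip r)
        (Sum.elim (fun i => Sum.inr (Sum.inr i))
          (Sum.elim (fun i => Sum.inr (Sum.inl i)) Sum.inl) x)
        (Sum.elim (fun i => Sum.inr (Sum.inr i))
          (Sum.elim (fun i => Sum.inr (Sum.inl i)) Sum.inl) y) := by
    intro m n k r s x y h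
    refine conn_induction (p := fun x y => conn (flip s) (flip r)
        (Sum.elim (fun i => Sum.inr (Sum.inr i))
          (Sum.elim (fun i => Sum.inr (Sum.inl i)) Sum.inl) x)
        (Sum.elim (fun i => Sum.inr (Sum.inr i))
          (Sum.elim (fun i => Sum.inr (Sum.inl i)) Sum.inl) y)) ?_ ?_ (fun _ => (conn _ _).refl _)
      (fun _ _ _ h => (conn _ _).symm h) (fun _ _ _ _ _ h h' => (conn _ _).trans h h') h
    · intro x y h
      have := conn_right (r := flip s) (s := flip r) (x := x.swap) (y := y.swap)
        (by simpa [flip_iff] using h)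
      rcases x with x | x <;> rcases y with y | y <;> exact this
    · intro x y h
      have := conn_left (r := flip s) (s := flip r) (x := x.swap) (y := y.swap)
        (by simpa [flip_iff] using h)
      rcases x with x | x <;> rcases y with y | y <;> exact this
  ext x y
  constructor
  · intro h
    have := key r s _ _ h
    rcases x with x | x <;> rcases y with y | y <;> exact this
  · intro h
    have := key (flip s) (flip r) _ _ h
    rw [flip_flip, flip_flip] at this
    rcases x with x | x <;> rcases y with y | y <;> exact this

end Upper

/-! ### Block sizes of products -/

section BlockSizes

/-- All classes have at most two elements. -/
def AtMostPairs {V : Type*} (r : Setoid V) : Prop := ∀ x y z, r x y → r x z → x = y ∨ x = z ∨ y = z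

/-- No class is a singleton. -/
def NoSingletons {V : Type*} (r : Setoid V) : Prop := ∀ x, ∃ y, y ≠ x ∧ r x y

theorem ncard_class_le_two_iff {V : Type*} [Finite V] (r : Setoid V) :
    (∀ X ∈ r.classes, X.ncard = 1 ∨ X.ncard = 2) ↔ AtMostPairs r := by
  constructor
  · intro h x y z hxy hxz
    have hX := h _ (r.mem_classes x)
    have : ¬ 2 < {y | r y x}.ncard := by omega
    rw [Set.two_lt_ncard (Set.toFinite _)] at this
    by_contra! hne
    exact this ⟨x, r.refl x, y, r.symm hxy, z, r.symm hxz, hne.1, hne.2.1, hne.2.2⟩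
  · rintro h _ ⟨x, rfl⟩
    have h0 : 0 < {y | r y x}.ncard := (Set.ncard_pos (Set.toFinite _)).2 ⟨x, r.refl x⟩
    have : ¬ 2 < {y | r y x}.ncard := by
      rw [Set.two_lt_ncard (Set.toFinite _)]
      rintro ⟨a, ha, b, hb, c, hc, hab, hac, hbc⟩
      rcases h a b c (r.trans ha (r.symm hb)) (r.trans ha (r.symm hc)) with h | h | h
      exacts [hab h, hac h, hbc h]
    omega

theorem ncard_class_eq_two_iff {V : Type*} [Finite V] (r : Setoid V) :
    (∀ X ∈ r.classes, X.ncard = 2) ↔ AtMostPairs r ∧ NoSingletons r := by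
  rw [← ncard_class_le_two_iff]
  constructor
  · refine fun h => ⟨fun X hX => Or.inr (h X hX), fun x => ?_⟩
    obtain ⟨y, hy, hne⟩ := Set.exists_ne_of_one_lt_ncard (a := x)
      (by rw [h _ (r.mem_classes x)]; norm_num)
    exact ⟨y, hne, r.symm hy⟩
  · rintro ⟨h, h'⟩ _ ⟨x, rfl⟩
    refine (h _ (r.mem_classes x)).resolve_left fun h1 => ?_
    obtain ⟨y, hy, hxy⟩ := h' x
    rw [Set.ncard_eq_one] at h1
    obtain ⟨a, ha⟩ := h1
    have h₁ : x ∈ ({a} : Set V) := ha ▸ r.refl x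
    have h₂ : y ∈ ({a} : Set V) := ha ▸ r.symm hxy
    exact hy (h₂.trans h₁.symm)

/-- If all classes have size two, then unions of classes have even size. -/
theorem even_card_of_pairs {V : Type*} {r : Setoid V} (h : AtMostPairs r) (h' : NoSingletons r)
    (S : Finset V) (hS : ∀ x ∈ S, ∀ y, r x y → y ∈ S) : Even S.card := by
  choose f hf hrf using h'
  -- Sending a vertex to its partner is an involution without fixed points, so the sum of ones over
  -- `S` vanishes modulo two.
  have := Finset.sum_involution (s := S) (f := fun _ => (1 : ZMod 2)) (fun x _ => f x)
    (fun _ _ => by decide) (fun x _ _ => hf x) (fun x hx => hS x hx _ (hrf x))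
    (fun x _ => by
      rcases h (f x) x (f (f x)) (r.symm (hrf x)) (hrf (f x)) with h | h | h
      · exact absurd h (hf x)
      · exact absurd h.symm (hf (f x))
      · exact h.symm)
  rw [Finset.sum_const, nsmul_eq_mul, mul_one] at this
  exact (ZMod.natCast_eq_zero_iff_even).1 this

/-- In a graph of maximum degree two, a component has at most two vertices of degree at most one. -/
theorem reachable_three_leaves {V : Type*} [Fintype V] (G : SimpleGraph V)
    (hdeg : ∀ v a b c, G.Adj v a → G.Adj v b → G.Adj v c → a = b ∨ a = c ∨ b = c)
    {x y z : V} (hleaf : ∀ v, v = x ∨ v = y ∨ v = z → ∀ a b, G.Adj v a → G.Adj v b → a = b)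
    (hxy : G.Reachable x y) (hxz : G.Reachable x z) : x = y ∨ x = z ∨ y = z := by
  classical
  by_contra! hne
  let C := G.connectedComponentMk x
  let H := G.induce C.supp
  have hH : H.Connected := C.connected_toSimpleGraph
  have hcard := hH.card_vert_le_card_edgeSet_add_one
  have hsum := H.sum_degrees_eq_twice_card_edges
  have hx : x ∈ C.supp := rfl
  have hy : y ∈ C.supp := SimpleGraph.ConnectedComponent.sound hxy.symm
  have hz : z ∈ C.supp := SimpleGraph.ConnectedComponent.sound hxz.symm
  let T : Finset C.supp := {⟨x, hx⟩, ⟨y, hy⟩, ⟨z, hz⟩}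
  have hT : T.card = 3 := by
    rw [Finset.card_eq_three]
    exact ⟨_, _, _, by simpa using hne.1, by simpa using hne.2.1, by simpa using hne.2.2, rfl⟩
  -- On `c` vertices the degree sum is then at most `2c - 3`, whereas a connected graph has at least
  -- `c - 1` edges and so degree sum at least `2c - 2`.
  have hd : ∀ v : C.supp, H.degree v + (if v ∈ T then 1 else 0) ≤ 2 := by
    intro v
    split_ifs with hv
    · have : H.degree v ≤ 1 := by
        rw [← SimpleGraph.card_neighborFinset_eq_degree, Finset.card_le_one]
        intro a ha b hb
        rw [SimpleGraph.mem_neighborFinset] at ha hb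
        refine Subtype.ext (hleaf v ?_ a b ha hb)
        simpa [T, Subtype.ext_iff] using hv
      omega
    · have : ¬ 2 < H.degree v := by
        rw [← SimpleGraph.card_neighborFinset_eq_degree, Finset.two_lt_card]
        rintro ⟨a, ha, b, hb, c, hc, hab, hac, hbc⟩
        rw [SimpleGraph.mem_neighborFinset] at ha hb hc
        rcases hdeg v a b c ha hb hc with h | h | h
        exacts [hab (Subtype.ext h), hac (Subtype.ext h), hbc (Subtype.ext h)]
      omega
  have hle := Finset.sum_le_sum fun v (_ : v ∈ Finset.univ) => hd v
  rw [Finset.sum_add_distrib, hsum, Finset.sum_ite_mem, Finset.univ_inter, Finset.sum_const, hT,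
    Finset.sum_const, Finset.card_univ] at hle
  rw [Nat.card_eq_fintype_card, Nat.card_eq_fintype_card, ← SimpleGraph.edgeFinset_card] at hcard
  simp only [smul_eq_mul] at hle
  omega

variable {m n k : ℕ} {r : Setoid (Vertex m n)} {s : Setoid (Vertex n k)}

theorem atMostPairs_flip (h : AtMostPairs r) : AtMostPairs (flip r) := fun x y z hxy hxz => by
  simpa only [Sum.swap_leftInverse.injective.eq_iff] using h x.swap y.swap z.swap hxy hxz

theorem noSingletons_flip (h : NoSingletons r) : NoSingletons (flip r) := fun x => by
  obtain ⟨y, hy, hxy⟩ := h x.swap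
  refine ⟨y.swap, fun h => hy (by simp [← h]), ?_⟩
  simpa [flip_iff] using hxy

/-- Without loops, every vertex of the product graph has at most one edge from each factor, and an
outer vertex has edges from one factor only. Components are therefore paths or cycles, and outer
vertices can only be ends of paths. -/
theorem atMostPairs_comp (hr : AtMostPairs r) (hs : AtMostPairs s) : AtMostPairs (comp r s) := by
  classical
  let G : SimpleGraph (Fin m ⊕ (Fin n ⊕ Fin k)) :=
    SimpleGraph.fromRel (ProductEdge ⟨m, n, r⟩ ⟨n, k, s⟩ rfl)
  have hG : ∀ {u v}, G.Adj u v → u ≠ v ∧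
      ((∃ x y, r x y ∧ u = Sum.map id Sum.inl x ∧ v = Sum.map id Sum.inl y) ∨
        ∃ x y, s x y ∧ u = Sum.inr x ∧ v = Sum.inr y) := by
    rintro u v ⟨hne, (⟨x, y, h⟩ | ⟨x, y, h⟩) | (⟨x, y, h⟩ | ⟨x, y, h⟩)⟩
    · exact ⟨hne, Or.inl ⟨x, y, h, rfl, rfl⟩⟩
    · exact ⟨hne, Or.inr ⟨x, y, h, by simp, by simp⟩⟩
    · exact ⟨hne, Or.inl ⟨y, x, r.symm h, rfl, rfl⟩⟩
    · exact ⟨hne, Or.inr ⟨y, x, s.symm h, by simp, by simp⟩⟩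
  have hinj : Function.Injective (Sum.map id Sum.inl : Vertex m n → Fin m ⊕ (Fin n ⊕ Fin k)) :=
    Function.Injective.sumMap Function.injective_id Sum.inl_injective
  have hone : ∀ {u v w : Fin m ⊕ (Fin n ⊕ Fin k)}, u ≠ v → u ≠ w →
      (∃ x y, r x y ∧ u = Sum.map id Sum.inl x ∧ v = Sum.map id Sum.inl y) →
      (∃ x y, r x y ∧ u = Sum.map id Sum.inl x ∧ w = Sum.map id Sum.inl y) → v = w := by
    rintro u v w huv huw ⟨x, y, h, rfl, rfl⟩ ⟨x', z, h', hx, rfl⟩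
    obtain rfl := hinj hx
    rcases hr x y z h h' with h | h | h
    exacts [absurd (congrArg _ h) huv, absurd (congrArg _ h) huw, congrArg _ h]
  have htwo : ∀ {u v w : Fin m ⊕ (Fin n ⊕ Fin k)}, u ≠ v → u ≠ w →
      (∃ x y, s x y ∧ u = Sum.inr x ∧ v = Sum.inr y) →
      (∃ x y, s x y ∧ u = Sum.inr x ∧ w = Sum.inr y) → v = w := by
    rintro u v w huv huw ⟨x, y, h, rfl, rfl⟩ ⟨x', z, h', hx, rfl⟩
    obtain rfl := Sum.inr_injective hx
    rcases hs x y z h h' with h | h | h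
    exacts [absurd (congrArg _ h) huv, absurd (congrArg _ h) huw, congrArg _ h]
  have hreach : ∀ {u v}, conn r s u v → G.Reachable u v := by
    intro u v h
    change Relation.EqvGen _ u v at h
    refine Relation.EqvGen.rec (motive := fun u v _ => G.Reachable u v) ?_
      (fun _ => SimpleGraph.Reachable.refl _) (fun _ _ _ h => h.symm)
      (fun _ _ _ _ _ h h' => h.trans h') h
    intro u v h
    by_cases huv : u = v
    · rw [huv]
    · exact SimpleGraph.Adj.reachable ⟨huv, Or.inl h⟩
  have hleaf : ∀ (v : Vertex m k) a b, G.Adj (Sum.map id Sum.inr v) a →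
      G.Adj (Sum.map id Sum.inr v) b → a = b := by
    intro v a b ha hb
    obtain ⟨hna, ha⟩ := hG ha
    obtain ⟨hnb, hb⟩ := hG hb
    rcases v with v | v
    · have h1 : ∀ w : Fin m ⊕ (Fin n ⊕ Fin k), ¬ ∃ x y, s x y ∧
          (Sum.map id Sum.inr (Sum.inl v : Vertex m k) : Fin m ⊕ (Fin n ⊕ Fin k)) = Sum.inr x ∧
          w = Sum.inr y := by
        rintro _ ⟨x, y, -, h, -⟩
        simp at h
      exact hone hna hnb (ha.resolve_right (h1 _)) (hb.resolve_right (h1 _))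
    · have h1 : ∀ w : Fin m ⊕ (Fin n ⊕ Fin k), ¬ ∃ x y, r x y ∧
          (Sum.map id Sum.inr (Sum.inr v : Vertex m k) : Fin m ⊕ (Fin n ⊕ Fin k)) =
            Sum.map id Sum.inl x ∧ w = Sum.map id Sum.inl y := by
        rintro _ ⟨x | x, y, -, h, -⟩ <;> simp at h
      exact htwo hna hnb (ha.resolve_left (h1 _)) (hb.resolve_left (h1 _))
  intro x y z hxy hxz
  have hinj' : Function.Injective (Sum.map id Sum.inr : Vertex m k → Fin m ⊕ (Fin n ⊕ Fin k)) :=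
    Function.Injective.sumMap Function.injective_id Sum.inr_injective
  have := reachable_three_leaves G ?_ ?_ (hreach hxy) (hreach hxz)
  · exact this.imp (fun h => hinj' h) (Or.imp (fun h => hinj' h) (fun h => hinj' h))
  · intro v a b c ha hb hc
    obtain ⟨hna, ha⟩ := hG ha
    obtain ⟨hnb, hb⟩ := hG hb
    obtain ⟨hnc, hc⟩ := hG hc
    rcases ha with ha | ha <;> rcases hb with hb | hb <;> rcases hc with hc | hc
    · exact Or.inl (hone hna hnb ha hb)
    · exact Or.inl (hone hna hnb ha hb)
    · exact Or.inr (Or.inl (hone hna hnc ha hc))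
    · exact Or.inr (Or.inr (htwo hnb hnc hb hc))
    · exact Or.inr (Or.inr (hone hnb hnc hb hc))
    · exact Or.inr (Or.inl (htwo hna hnc ha hc))
    · exact Or.inl (htwo hna hnb ha hb)
    · exact Or.inl (htwo hna hnb ha hb)
  · rintro _ (rfl | rfl | rfl) a b ha hb
    exacts [hleaf _ a b ha hb, hleaf _ a b ha hb, hleaf _ a b ha hb]

theorem noSingletons_comp (hr : AtMostPairs r) (hr' : NoSingletons r) (hs : AtMostPairs s)
    (hs' : NoSingletons s) : NoSingletons (comp r s) := by
  classical
  intro v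
  by_contra! hv
  have hA := even_card_of_pairs hr hr'
    (Finset.univ.filter fun x => conn r s (Sum.map id Sum.inr v) (Sum.map id Sum.inl x)) (by
      simp only [Finset.mem_filter, Finset.mem_univ, true_and]
      exact fun x hx y hxy => (conn r s).trans hx (conn_left hxy))
  have hB := even_card_of_pairs hs hs'
    (Finset.univ.filter fun x => conn r s (Sum.map id Sum.inr v) (Sum.inr x)) (by
      simp only [Finset.mem_filter, Finset.mem_univ, true_and]
      exact fun x hx y hxy => (conn r s).trans hx (conn_right hxy))
  have hC : (Finset.univ.filter fun x : Vertex m k =>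
      conn r s (Sum.map id Sum.inr v) (Sum.map id Sum.inr x)).card = 1 := by
    rw [Finset.card_eq_one]
    refine ⟨v, Finset.ext fun x => ?_⟩
    simp only [Finset.mem_filter, Finset.mem_univ, true_and, Finset.mem_singleton]
    exact ⟨fun h => by_contra fun h' => hv x h' h, fun h => h ▸ (conn r s).refl _⟩
  -- Count the component of `v` row by row: top plus middle is even, middle plus bottom is even, but
  -- top plus bottom is one if `v` is a singleton of the product.
  let P : Fin m ⊕ (Fin n ⊕ Fin k) → ℕ := fun u => if conn r s (Sum.map id Sum.inr v) u then 1 else 0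
  have hA' : Even (∑ i, P (Sum.inl i) + ∑ i, P (Sum.inr (Sum.inl i))) := by
    rw [Finset.card_filter, Fintype.sum_sum_type] at hA
    exact hA
  have hB' : Even (∑ i, P (Sum.inr (Sum.inl i)) + ∑ i, P (Sum.inr (Sum.inr i))) := by
    rw [Finset.card_filter, Fintype.sum_sum_type] at hB
    exact hB
  have hC' : ∑ i, P (Sum.inl i) + ∑ i, P (Sum.inr (Sum.inr i)) = 1 := by
    rw [Finset.card_filter, Fintype.sum_sum_type] at hC
    exact hC
  rw [Nat.even_iff] at hA' hB'
  omega

end BlockSizes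

/-! ### Products of planar partitions -/

section Planar

variable {m n k : ℕ}

/-- A set partition is non-crossing in the boundary order. -/
def Planar (r : Setoid (Vertex m n)) : Prop := IsPlanar ⟨m, n, r⟩

theorem boundaryPos_injective : Function.Injective (boundaryPos : Vertex m n → ℕ) := by
  rintro (x | x) (y | y) h <;> simp only [boundaryPos, Fin.val_rev] at h
  · exact congrArg _ (Fin.ext h)
  · have := x.2; omega
  · have := y.2; omega
  · have := x.2; have := y.2; exact congrArg _ (Fin.ext (by omega))

/-- Reflection reverses the boundary order, so a crossing becomes a crossing read backwards. -/
theorem boundaryPos_swap (x : Vertex m n) :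
    boundaryPos x.swap + boundaryPos x + 1 = m + n := by
  rcases x with x | x <;> simp only [boundaryPos, Fin.val_rev, Sum.swap_inl, Sum.swap_inr] <;>
    have := x.2 <;> omega

theorem planar_flip {r : Setoid (Vertex m n)} (h : Planar r) : Planar (flip r) := by
  intro w x y z hwx hxy hyz hwy hxz
  have hw := boundaryPos_swap w
  have hx := boundaryPos_swap x
  have hy := boundaryPos_swap y
  have hz := boundaryPos_swap z
  have := h z.swap y.swap x.swap w.swap (by omega) (by omega) (by omega) (r.symm hxz) (r.symm hwy)
  exact r.trans hwy (r.trans (r.symm this) (r.symm hxz))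

/-- The indicator of a proposition modulo two. -/
noncomputable def indicator (p : Prop) : ZMod 2 := open Classical in if p then 1 else 0

/-- Reduces parity identities to propositional ones, which decision procedures can settle from
inequalities between positions. -/
theorem indicator_add_eq_iff {a b c d : Prop} :
    indicator a + indicator b = indicator c + indicator d ↔ ((a ↔ b) ↔ (c ↔ d)) := by
  unfold indicator
  by_cases a <;> by_cases b <;> by_cases c <;> by_cases d <;> simp_all <;> decide

/-- Two vertices in one block do not separate two vertices in another block. -/
theorem Planar.not_separated {r : Setoid (Vertex m n)} (hr : Planar r) {a b x y : Vertex m n}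
    (hab : r a b) (hxy : r x y) (hax : ¬ r a x) :
    indicator (boundaryPos a < boundaryPos x) + indicator (boundaryPos b < boundaryPos x) =
      indicator (boundaryPos a < boundaryPos y) + indicator (boundaryPos b < boundaryPos y) := by
  have ne : ∀ {u v}, ¬ r u v → boundaryPos u ≠ boundaryPos v := fun h h' =>
    h (boundaryPos_injective h' ▸ r.refl _)
  have hay : ¬ r a y := fun h => hax (r.trans h (r.symm hxy))
  have hbx : ¬ r b x := fun h => hax (r.trans hab h)
  have hby : ¬ r b y := fun h => hay (r.trans hab h)
  have n1 := ne hax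
  have n2 := ne hay
  have n3 := ne hbx
  have n4 := ne hby
  -- The instances `c1` to `c8` exclude all eight alternating orders of the pairs `a, b` and `x, y`.
  have c : ∀ {a b x y}, r a b → r x y → ¬ r a x →
      ¬ (boundaryPos a < boundaryPos x ∧ boundaryPos x < boundaryPos b ∧
        boundaryPos b < boundaryPos y) := fun h h' h'' ⟨h1, h2, h3⟩ =>
    h'' (hr _ _ _ _ h1 h2 h3 h h')
  have c1 := c hab hxy hax
  have c2 := c hab (r.symm hxy) hay
  have c3 := c (r.symm hab) hxy hbx
  have c4 := c (r.symm hab) (r.symm hxy) hby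
  have c5 := c hxy hab (fun h => hax (r.symm h))
  have c6 := c hxy (r.symm hab) (fun h => hbx (r.symm h))
  have c7 := c (r.symm hxy) hab (fun h => hay (r.symm h))
  have c8 := c (r.symm hxy) (r.symm hab) (fun h => hby (r.symm h))
  rw [indicator_add_eq_iff]
  omega

/-- Positions of the vertices of the product graph: along the top row, then back along the middle
row, then back along the bottom row. -/
def rowPos : Fin m ⊕ (Fin n ⊕ Fin k) → ℕ
  | Sum.inl i => i
  | Sum.inr (Sum.inl j) => m + Fin.rev j
  | Sum.inr (Sum.inr l) => m + n + Fin.rev l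

/-- The vertex is to the left of the middle vertex `j`, or on an outer row. -/
def leftOf (j : Fin n) : Fin m ⊕ (Fin n ⊕ Fin k) → Prop
  | Sum.inr (Sum.inl i) => j < i
  | _ => True

variable {r : Setoid (Vertex m n)} {s : Setoid (Vertex n k)}

theorem boundaryPos_lt_inr (a : Vertex m n) (j : Fin n) :
    boundaryPos a < boundaryPos (Sum.inr j : Vertex m n) ↔
      leftOf j (Sum.map id Sum.inl a : Fin m ⊕ (Fin n ⊕ Fin k)) := by
  rcases a with a | a
  · simp only [boundaryPos, leftOf, Sum.map_inl, iff_true]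
    omega
  · simp only [boundaryPos, leftOf, Sum.map_inr, Fin.val_rev, Fin.lt_def]
    omega

/-- The boundary orders of the two factors traverse the middle row in opposite directions, whence
the negation. It disappears once the indicators of two endpoints are added. -/
theorem boundaryPos_lt_inl {a : Vertex n k} {j : Fin n} (h : a ≠ Sum.inl j) :
    boundaryPos a < boundaryPos (Sum.inl j : Vertex n k) ↔
      ¬ leftOf j (Sum.inr a : Fin m ⊕ (Fin n ⊕ Fin k)) := by
  rcases a with a | a
  · simp only [ne_eq, Sum.inl.injEq, Fin.ext_iff] at h
    simp only [boundaryPos, leftOf, Fin.lt_def]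
    omega
  · simp only [boundaryPos, leftOf, not_true, iff_false]
    omega

theorem rowPos_left (a : Vertex m n) :
    rowPos (Sum.map id Sum.inl a : Fin m ⊕ (Fin n ⊕ Fin k)) = boundaryPos a := by
  rcases a with a | a <;> rfl

theorem le_rowPos_inr (a : Vertex n k) :
    m ≤ rowPos (Sum.inr a : Fin m ⊕ (Fin n ⊕ Fin k)) := by
  rcases a with a | a <;> simp only [rowPos] <;> omega

theorem boundaryPos_lt (a : Vertex m n) : boundaryPos a < m + n := by
  have := boundaryPos_swap a
  omega

/-- The functions `g` and `h` count modulo two on which side of a walk from `p` to `q` the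
vertices of the two factors lie. -/
structure Sides (r : Setoid (Vertex m n)) (s : Setoid (Vertex n k))
    (p q : Fin m ⊕ (Fin n ⊕ Fin k)) (g : Vertex m n → ZMod 2) (h : Vertex n k → ZMod 2) :
    Prop where
  left : ∀ x y, r x y → ¬ conn r s p (Sum.map id Sum.inl x) → g x = g y
  right : ∀ x y, s x y → ¬ conn r s p (Sum.inr x) → h x = h y
  middle : ∀ j, ¬ conn r s p (Sum.inr (Sum.inl j)) →
    g (Sum.inr j) + h (Sum.inl j) = indicator (leftOf j p) + indicator (leftOf j q)
  top : ∀ i, g (Sum.inl i) = indicator (rowPos p < i) + indicator (rowPos q < i)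
  bottom : ∀ l, h (Sum.inr l) = indicator (rowPos p < m + n + Fin.rev l) +
    indicator (rowPos q < m + n + Fin.rev l)

theorem add_add_cancel_middle (a b c : ZMod 2) : (a + b) + (b + c) = a + c := by
  revert a b c
  decide

/-- An edge is a chord of one of the two rectangles. It separates the vertices there and, by
planarity, cuts no other block; the other rectangle gets the zero function. Along a walk these
functions add up. -/
theorem exists_sides (hr : Planar r) (hs : Planar s) {p q : Fin m ⊕ (Fin n ⊕ Fin k)}
    (hpq : conn r s p q) : ∃ g h, Sides r s p q g h := by
  refine conn_induction (p := fun p q => ∃ g h, Sides r s p q g h) ?_ ?_ ?_ ?_ ?_ hpq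
  · intro a b hab
    refine ⟨fun x => indicator (boundaryPos a < boundaryPos x) +
      indicator (boundaryPos b < boundaryPos x), fun _ => 0, ⟨?_, fun _ _ _ _ => rfl, ?_, ?_, ?_⟩⟩
    · exact fun x y hxy h => hr.not_separated hab hxy fun h' => h (conn_left h')
    · intro j _
      rw [add_zero, indicator_add_eq_iff]
      rw [boundaryPos_lt_inr (k := k), boundaryPos_lt_inr (k := k)]
    · intro i
      rw [rowPos_left, rowPos_left]
      rfl
    · intro l
      rw [← add_zero (0 : ZMod 2)]
      have : (0 : ZMod 2) = indicator False := by simp [indicator]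
      rw [this, indicator_add_eq_iff]
      rw [rowPos_left, rowPos_left]
      have h₁ : boundaryPos a < m + n + Fin.rev l :=
        (boundaryPos_lt a).trans_le (Nat.le_add_right _ _)
      have h₂ : boundaryPos b < m + n + Fin.rev l :=
        (boundaryPos_lt b).trans_le (Nat.le_add_right _ _)
      tauto
  · intro a b hab
    refine ⟨fun _ => 0, fun x => indicator (boundaryPos a < boundaryPos x) +
      indicator (boundaryPos b < boundaryPos x), ⟨fun _ _ _ _ => rfl, ?_, ?_, ?_, ?_⟩⟩
    · exact fun x y hxy h => hs.not_separated hab hxy fun h' => h (conn_right h')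
    · intro j hj
      have ha : a ≠ Sum.inl j := fun h => hj (h ▸ (conn r s).refl _)
      have hb : b ≠ Sum.inl j := fun h => hj (h ▸ conn_right hab)
      rw [zero_add, indicator_add_eq_iff]
      rw [boundaryPos_lt_inl (m := m) ha, boundaryPos_lt_inl (m := m) hb]
      tauto
    · intro i
      rw [← add_zero (0 : ZMod 2)]
      have : (0 : ZMod 2) = indicator False := by simp [indicator]
      rw [this, indicator_add_eq_iff]
      have h₁ := (i.2.trans_le (le_rowPos_inr a)).not_gt
      have h₂ := (i.2.trans_le (le_rowPos_inr b)).not_gt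
      tauto
    · intro l
      rw [indicator_add_eq_iff]
      rcases a with a | a <;> rcases b with b | b <;>
        simp only [boundaryPos, rowPos, Fin.val_rev] <;> omega
  · refine fun p => ⟨fun _ => 0, fun _ => 0, ⟨fun _ _ _ _ => rfl, fun _ _ _ _ => rfl, ?_, ?_, ?_⟩⟩
      <;> intros <;> simp [CharTwo.add_self_eq_zero]
  · rintro p q hpq ⟨g, h, H⟩
    have off : ∀ {v}, ¬ conn r s q v → ¬ conn r s p v := fun hq hp =>
      hq ((conn r s).trans ((conn r s).symm hpq) hp)
    exact ⟨g, h, fun x y hxy hq => H.left x y hxy (off hq),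
      fun x y hxy hq => H.right x y hxy (off hq),
      fun j hq => (H.middle j (off hq)).trans (add_comm _ _),
      fun i => (H.top i).trans (add_comm _ _), fun i => (H.bottom i).trans (add_comm _ _)⟩
  -- The terms of the intermediate vertex `q` occur twice and cancel in characteristic two.
  · rintro p q t hpq hqt ⟨g, h, H⟩ ⟨g', h', H'⟩
    have off : ∀ {v}, ¬ conn r s p v → ¬ conn r s q v := fun hp hq => hp ((conn r s).trans hpq hq)
    refine ⟨g + g', h + h', fun x y hxy hp => ?_, fun x y hxy hp => ?_, fun j hp => ?_, fun i => ?_,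
      fun i => ?_⟩
    · rw [Pi.add_apply, Pi.add_apply, H.left x y hxy hp, H'.left x y hxy (off hp)]
    · rw [Pi.add_apply, Pi.add_apply, H.right x y hxy hp, H'.right x y hxy (off hp)]
    · rw [Pi.add_apply, Pi.add_apply, add_add_add_comm, H.middle j hp, H'.middle j (off hp),
        add_add_cancel_middle]
    · rw [Pi.add_apply, H.top, H'.top, add_add_cancel_middle]
    · rw [Pi.add_apply, H.bottom, H'.bottom, add_add_cancel_middle]

/-- A walk from `w` to `y` splits the stacked rectangles into two sides. A different component stays
on one side, so it cannot contain both `x` and `z` if these are separated by `w` and `y`. -/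
theorem planar_comp (hr : Planar r) (hs : Planar s) : Planar (comp r s) := by
  intro w x y z hwx hxy hyz hwy hxz
  by_contra hne
  obtain ⟨g, h, H⟩ := exists_sides hr hs (comp_iff.1 hwy)
  let f : Fin m ⊕ (Fin n ⊕ Fin k) → ZMod 2 :=
    Sum.elim (fun i => g (Sum.inl i)) (Sum.elim (fun j => g (Sum.inr j)) fun l => h (Sum.inr l))
  have houter : ∀ (v : Vertex m k) j,
      leftOf j (Sum.map id Sum.inr v : Fin m ⊕ (Fin n ⊕ Fin k)) ↔ True := by
    rintro (v | v) j <;> rfl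
  -- As both ends of the walk are on outer rows, the two side functions agree on the middle row and
  -- glue to `f`.
  have hmid : ∀ j, ¬ conn r s (Sum.map id Sum.inr w) (Sum.inr (Sum.inl j)) →
      g (Sum.inr j) = h (Sum.inl j) := by
    intro j hj
    have := H.middle j hj
    rw [houter, houter, CharTwo.add_self_eq_zero] at this
    exact CharTwo.add_eq_zero.1 this
  have hright : ∀ v : Vertex n k, ¬ conn r s (Sum.map id Sum.inr w) (Sum.inr v) →
      f (Sum.inr v) = h v := by
    rintro (v | v) hv
    exacts [hmid v hv, rfl]
  have hconst : ∀ {u v}, conn r s u v → ¬ conn r s (Sum.map id Sum.inr w) u → f u = f v := by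
    intro u v huv
    refine conn_induction (p := fun u v => ¬ conn r s (Sum.map id Sum.inr w) u → f u = f v)
      ?_ ?_ (fun _ _ => rfl) ?_ ?_ huv
    · intro a b hab ha
      have := H.left a b hab ha
      rcases a with a | a <;> rcases b with b | b <;> exact this
    · intro a b hab ha
      rw [hright a ha, hright b fun hb =>
        ha ((conn r s).trans hb ((conn r s).symm (conn_right hab)))]
      exact H.right a b hab ha
    · exact fun a b hab hf hb => (hf fun ha => hb ((conn r s).trans ha hab)).symm
    · exact fun a b c hab hbc hf hf' ha => (hf ha).trans
        (hf' fun hb => ha ((conn r s).trans hb ((conn r s).symm hab)))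
  have hpos : ∀ v : Vertex m k, f (Sum.map id Sum.inr v) =
      indicator (boundaryPos w < boundaryPos v) + indicator (boundaryPos y < boundaryPos v) := by
    rintro (v | v)
    · refine (H.top v).trans (indicator_add_eq_iff.2 ?_)
      rcases w with w | w <;> rcases y with y | y <;>
        simp only [boundaryPos, rowPos, Sum.map_inl, Sum.map_inr, id_eq] <;> omega
    · refine (H.bottom v).trans (indicator_add_eq_iff.2 ?_)
      rcases w with w | w <;> rcases y with y | y <;>
        simp only [boundaryPos, rowPos, Sum.map_inl, Sum.map_inr, id_eq] <;> omega
  -- Exactly one of `w`, `y` precedes `x`, while both precede `z`; so `f` is one at `x` and zero at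
  -- `z`.
  have hfin := hconst hxz hne
  rw [hpos, hpos, indicator_add_eq_iff] at hfin
  omega

end Planar

/-! ### Closure of the six categories under reflection and products -/

section Kinds

variable {m n k q : ℕ}

/-- The partition given by `r` belongs to the category `K`. -/
def Kind.Mem (K : Kind) (r : Setoid (Vertex m n)) : Prop := Diagram.mk m n r ∈ K.morphisms

theorem isPartialBrauer_iff (r : Setoid (Vertex m n)) :
    IsPartialBrauer ⟨m, n, r⟩ ↔ AtMostPairs r := ncard_class_le_two_iff r

theorem isBrauer_iff (r : Setoid (Vertex m n)) :
    IsBrauer ⟨m, n, r⟩ ↔ AtMostPairs r ∧ NoSingletons r := ncard_class_eq_two_iff r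

theorem Kind.Mem.flip {K : Kind} {r : Setoid (Vertex m n)} (h : K.Mem r) :
    K.Mem (DiagramCategories.flip r) := by
  have pb : IsPartialBrauer ⟨m, n, r⟩ → IsPartialBrauer ⟨n, m, DiagramCategories.flip r⟩ := by
    rw [isPartialBrauer_iff, isPartialBrauer_iff]
    exact atMostPairs_flip
  have b : IsBrauer ⟨m, n, r⟩ → IsBrauer ⟨n, m, DiagramCategories.flip r⟩ := by
    rw [isBrauer_iff, isBrauer_iff]
    exact fun h => ⟨atMostPairs_flip h.1, noSingletons_flip h.2⟩
  cases K
  exacts [trivial, pb h, b h, planar_flip h, ⟨pb h.1, planar_flip h.2⟩, ⟨b h.1, planar_flip h.2⟩]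

theorem Kind.Mem.comp {K : Kind} {r : Setoid (Vertex m n)} {s : Setoid (Vertex n k)} (h : K.Mem r)
    (h' : K.Mem s) : K.Mem (DiagramCategories.comp r s) := by
  have pb : IsPartialBrauer ⟨m, n, r⟩ → IsPartialBrauer ⟨n, k, s⟩ →
      IsPartialBrauer ⟨m, k, DiagramCategories.comp r s⟩ := by
    rw [isPartialBrauer_iff, isPartialBrauer_iff, isPartialBrauer_iff]
    exact atMostPairs_comp
  have b : IsBrauer ⟨m, n, r⟩ → IsBrauer ⟨n, k, s⟩ →
      IsBrauer ⟨m, k, DiagramCategories.comp r s⟩ := by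
    rw [isBrauer_iff, isBrauer_iff, isBrauer_iff]
    exact fun h h' => ⟨atMostPairs_comp h.1 h'.1, noSingletons_comp h.1 h.2 h'.1 h'.2⟩
  cases K
  exacts [trivial, pb h h', b h h', planar_comp h h', ⟨pb h.1 h'.1, planar_comp h.2 h'.2⟩,
    ⟨b h.1 h'.1, planar_comp h.2 h'.2⟩]

end Kinds

/-! ### Rank and upper halves -/

section Transversals

variable {m n k q p : ℕ}

/-- The least upper vertices of the transversals, in increasing order. -/
structure UpperReps (r : Setoid (Vertex m n)) (e : Fin q → Fin m) : Prop where
  strictMono : StrictMono e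
  inDom : ∀ i, InDom r (e i)
  le : ∀ i x, r (Sum.inl (e i)) (Sum.inl x) → e i ≤ x
  cover : ∀ x, InDom r x → ∃ i, r (Sum.inl x) (Sum.inl (e i))

theorem InDom.congr {r : Setoid (Vertex m n)} {x y : Fin m} (hx : InDom r x)
    (h : r (Sum.inl x) (Sum.inl y)) : InDom r y :=
  hx.imp fun _ hj => r.trans (r.symm h) hj

theorem UpperReps.eq {r : Setoid (Vertex m n)} {e : Fin q → Fin m} (h : UpperReps r e)
    {i j : Fin q} (hij : r (Sum.inl (e i)) (Sum.inl (e j))) : i = j :=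
  h.strictMono.injective (le_antisymm (h.le _ _ hij) (h.le _ _ (r.symm hij)))

theorem UpperReps.rank_eq {r : Setoid (Vertex m n)} {e : Fin q → Fin m} (h : UpperReps r e) :
    rank ⟨m, n, r⟩ = q := by
  have hset : {X ∈ blocks ⟨m, n, r⟩ | IsTransversal X} =
      Set.range fun i => {y | r y (Sum.inl (e i))} := by
    ext X
    constructor
    · rintro ⟨⟨v, rfl⟩, ⟨x, hx⟩, y, hy⟩
      obtain ⟨i, hi⟩ := h.cover x ⟨y, r.trans hx (r.symm hy)⟩
      refine ⟨i, Set.ext fun z => ?_⟩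
      have := r.trans (r.symm hx) hi
      exact ⟨fun hz => r.trans hz (r.symm this), fun hz => r.trans hz this⟩
    · rintro ⟨i, rfl⟩
      obtain ⟨y, hy⟩ := h.inDom i
      exact ⟨r.mem_classes _, ⟨e i, r.refl _⟩, y, r.symm hy⟩
  rw [rank, hset, ← Set.image_univ, Set.ncard_image_of_injective, Set.ncard_univ, Nat.card_fin]
  intro i j hij
  have : Sum.inl (e i) ∈ {y | r y (Sum.inl (e j))} :=
    (Set.ext_iff.1 hij _).1 (r.refl _)
  exact h.eq this

theorem exists_upperReps (r : Setoid (Vertex m n)) :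
    ∃ e : Fin (rank ⟨m, n, r⟩) → Fin m, UpperReps r e := by
  classical
  -- Any such list has length equal to the rank, so the length may be left open during the
  -- construction.
  suffices h : ∃ q, ∃ e : Fin q → Fin m, UpperReps r e by
    obtain ⟨q, e, he⟩ := h
    obtain rfl := he.rank_eq
    exact ⟨e, he⟩
  let T : Finset (Fin m) := Finset.univ.filter fun i =>
    InDom r i ∧ ∀ x, r (Sum.inl i) (Sum.inl x) → i ≤ x
  have hT : ∀ i, T.orderEmbOfFin rfl i ∈ T := T.orderEmbOfFin_mem rfl
  refine ⟨T.card, T.orderEmbOfFin rfl, (T.orderEmbOfFin rfl).strictMono,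
    fun i => (Finset.mem_filter.1 (hT i)).2.1, fun i => (Finset.mem_filter.1 (hT i)).2.2,
    fun x hx => ?_⟩
  let B : Finset (Fin m) := Finset.univ.filter fun y => r (Sum.inl x) (Sum.inl y)
  have hB : B.Nonempty := ⟨x, Finset.mem_filter.2 ⟨Finset.mem_univ _, r.refl _⟩⟩
  have hmin : r (Sum.inl x) (Sum.inl (B.min' hB)) := (Finset.mem_filter.1 (B.min'_mem hB)).2
  have hmem : B.min' hB ∈ T := Finset.mem_filter.2 ⟨Finset.mem_univ _, hx.congr hmin, fun y hy =>
    B.min'_le _ (Finset.mem_filter.2 ⟨Finset.mem_univ _, r.trans hmin hy⟩)⟩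
  have : B.min' hB ∈ Set.range (T.orderEmbOfFin rfl) := by
    rw [Finset.range_orderEmbOfFin]
    exact hmem
  obtain ⟨i, hi⟩ := this
  exact ⟨i, hi ▸ hmin⟩

theorem UpperLe.inDom {r : Setoid (Vertex m n)} {s : Setoid (Vertex m k)} (h : UpperLe r s)
    {i : Fin m} (hi : InDom r i) : InDom s i := by
  by_contra hs
  exact (h.2 i hs).1 hi

/-- Each transversal of `r` meets a transversal of `s`, and different ones meet different ones
because the kernel of `s` is contained in that of `r`. -/
theorem UpperLe.rank_le {r : Setoid (Vertex m n)} {s : Setoid (Vertex m k)} (h : UpperLe r s) :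
    rank ⟨m, n, r⟩ ≤ rank ⟨m, k, s⟩ := by
  obtain ⟨e, he⟩ := exists_upperReps r
  obtain ⟨e', he'⟩ := exists_upperReps s
  choose f hf using fun i => he'.cover (e i) (h.inDom (he.inDom i))
  have hinj : Function.Injective f := fun i j hij => he.eq (h.1 _ _ (by
    have hi := hf i
    rw [hij] at hi
    exact s.trans hi (s.symm (hf j))))
  simpa using Fintype.card_le_of_injective f hinj

theorem rank_flip (r : Setoid (Vertex m n)) : rank ⟨n, m, flip r⟩ = rank ⟨m, n, r⟩ := by
  have key : ∀ {m n : ℕ} (r : Setoid (Vertex m n)), rank ⟨m, n, r⟩ ≤ rank ⟨n, m, flip r⟩ := by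
    intro m n r
    obtain ⟨e, he⟩ := exists_upperReps r
    obtain ⟨e', he'⟩ := exists_upperReps (flip r)
    choose g hg using he.inDom
    choose f hf using fun i => he'.cover (g i) ⟨e i, r.symm (hg i)⟩
    have hf : ∀ i, r (Sum.inr (g i)) (Sum.inr (e' (f i))) := hf
    have hinj : Function.Injective f := fun i j hij => he.eq (by
      have hi := hf i
      rw [hij] at hi
      exact r.trans (hg i) (r.trans (r.trans hi (r.symm (hf j))) (r.symm (hg j))))
    simpa using Fintype.card_le_of_injective f hinj
  refine le_antisymm ?_ (key r)
  simpa using key (flip r)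

/-- The rank of a Brauer diagram has the parity of the number of upper vertices. -/
theorem rank_modEq {r : Setoid (Vertex m n)} (h : IsBrauer ⟨m, n, r⟩) :
    rank ⟨m, n, r⟩ ≡ m [MOD 2] := by
  classical
  rw [isBrauer_iff] at h
  obtain ⟨e, he⟩ := exists_upperReps r
  -- A transversal of size two has a single upper vertex, so the domain consists of the
  -- representatives. The remaining upper vertices form a union of pairs.
  have hcard : (Finset.univ.filter fun x => InDom r x).card = rank ⟨m, n, r⟩ := by
    have : (Finset.univ.filter fun x => InDom r x) =
        Finset.univ.map ⟨e, he.strictMono.injective⟩ := by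
      ext x
      simp only [Finset.mem_filter, Finset.mem_univ, true_and, Finset.mem_map,
        Function.Embedding.coeFn_mk]
      constructor
      · rintro ⟨j, hj⟩
        obtain ⟨i, hi⟩ := he.cover x ⟨j, hj⟩
        rcases h.1 _ _ _ hj hi with h | h | h
        exacts [by simp at h, ⟨i, (Sum.inl_injective h).symm⟩, by simp at h]
      · rintro ⟨i, rfl⟩
        exact he.inDom i
    rw [this, Finset.card_map, Finset.card_univ, Fintype.card_fin]
  have heven := even_card_of_pairs h.1 h.2
    ((Finset.univ.filter fun x => ¬ InDom r x).map ⟨Sum.inl, Sum.inl_injective⟩) (by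
      simp only [Finset.mem_map, Finset.mem_filter, Finset.mem_univ, true_and,
        Function.Embedding.coeFn_mk]
      rintro _ ⟨x, hx, rfl⟩ (y | y) hxy
      · exact ⟨y, fun hy => hx (hy.congr (r.symm hxy)), rfl⟩
      · exact absurd ⟨y, hxy⟩ hx)
  rw [Finset.card_map, Nat.even_iff] at heven
  have htot := Finset.card_filter_add_card_filter_not (s := (Finset.univ : Finset (Fin m)))
    (fun x => InDom r x)
  rw [Finset.card_univ, Fintype.card_fin, hcard] at htot
  unfold Nat.ModEq
  omega

/-- The upper half of a partition: each transversal is cut and attached to a single lower vertex. -/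
def upperHalf (r : Setoid (Vertex m n)) (e : Fin q → Fin m) : Setoid (Vertex m q) :=
  r.comap (Sum.elim Sum.inl fun i => Sum.inl (e i))

theorem upperHalf_iff {r : Setoid (Vertex m n)} {e : Fin q → Fin m} {x y : Vertex m q} :
    upperHalf r e x y ↔ r (Sum.elim Sum.inl (fun i => Sum.inl (e i)) x)
      (Sum.elim Sum.inl (fun i => Sum.inl (e i)) y) := Iff.rfl

theorem UpperReps.inDom_upperHalf {r : Setoid (Vertex m n)} {e : Fin q → Fin m}
    (h : UpperReps r e) {x : Fin m} : InDom (upperHalf r e) x ↔ InDom r x :=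
  ⟨fun ⟨i, hi⟩ => (h.inDom i).congr (r.symm hi), h.cover x⟩

theorem UpperReps.upperHalf_upperLe {r : Setoid (Vertex m n)} {e : Fin q → Fin m}
    (h : UpperReps r e) : UpperLe (upperHalf r e) r :=
  upperLe_of_eq (fun _ _ => Iff.rfl) fun _ => h.inDom_upperHalf

theorem UpperReps.upperLe_upperHalf {r : Setoid (Vertex m n)} {e : Fin q → Fin m}
    (h : UpperReps r e) : UpperLe r (upperHalf r e) :=
  upperLe_of_eq (fun _ _ => Iff.rfl) fun _ => h.inDom_upperHalf.symm

theorem UpperReps.atMostPairs {r : Setoid (Vertex m n)} {e : Fin q → Fin m} (he : UpperReps r e)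
    (hr : AtMostPairs r) : AtMostPairs (upperHalf r e) := by
  have pair : ∀ i x, r (Sum.inl (e i)) (Sum.inl x) → x = e i := by
    intro i x h
    obtain ⟨j, hj⟩ := he.inDom i
    rcases hr _ _ _ h hj with h | h | h
    exacts [(Sum.inl_injective h).symm, by simp at h, by simp at h]
  rintro (x | x) (y | y) (z | z) hxy hxz <;>
    simp only [upperHalf_iff, Sum.elim_inl, Sum.elim_inr] at hxy hxz
  · simpa using hr _ _ _ hxy hxz
  · exact Or.inl (congrArg _ ((pair z x (r.symm hxz)).trans
      (pair z y (r.trans (r.symm hxz) hxy)).symm))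
  · exact Or.inr (Or.inl (congrArg _ ((pair y x (r.symm hxy)).trans
      (pair y z (r.trans (r.symm hxy) hxz)).symm)))
  · exact Or.inr (Or.inr (congrArg _ (he.eq (r.trans (r.symm hxy) hxz))))
  · exact Or.inr (Or.inr (congrArg _ ((pair x y hxy).trans (pair x z hxz).symm)))
  · exact Or.inr (Or.inl (congrArg _ (he.eq hxz)))
  · exact Or.inl (congrArg _ (he.eq hxy))
  · exact Or.inl (congrArg _ (he.eq hxy))

theorem UpperReps.noSingletons {r : Setoid (Vertex m n)} {e : Fin q → Fin m} (he : UpperReps r e)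
    (hr' : NoSingletons r) : NoSingletons (upperHalf r e) := by
  rintro (x | i)
  · obtain ⟨y | y, hy, hxy⟩ := hr' (Sum.inl x)
    · exact ⟨Sum.inl y, fun h => hy (congrArg _ (Sum.inl_injective h)), hxy⟩
    · obtain ⟨i, hi⟩ := he.cover x ⟨y, hxy⟩
      exact ⟨Sum.inr i, by simp, hi⟩
  · exact ⟨Sum.inl (e i), by simp, r.refl _⟩

theorem UpperReps.planar {r : Setoid (Vertex m n)} {e : Fin q → Fin m} (he : UpperReps r e)
    (hr : Planar r) : Planar (upperHalf r e) := by
  have up : ∀ {a b c d : Fin m} {v : Vertex m n}, a < b → b < c → r (Sum.inl a) (Sum.inl c) →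
      r (Sum.inl b) v → Sum.inl d = v ∧ c < d ∨ v.isRight → r (Sum.inl a) (Sum.inl b) := by
    intro a b c d v hab hbc hac hbv hv
    refine hr (Sum.inl a) (Sum.inl b) (Sum.inl c) v hab hbc ?_ hac hbv
    rcases hv with ⟨rfl, hv⟩ | hv
    · exact hv
    · rcases v with v | v
      · simp at hv
      · simp only [boundaryPos]
        omega
  have low : ∀ {i : Fin q} {v : Vertex m q}, boundaryPos (Sum.inr i : Vertex m q) < boundaryPos v →
      ∃ j, v = Sum.inr j ∧ j < i := by
    rintro i (v | v) h <;> simp only [boundaryPos, Fin.val_rev] at h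
    · omega
    · exact ⟨v, rfl, by rw [Fin.lt_def]; omega⟩
  rintro w x y z hwx hxy hyz hwy hxz
  change upperHalf r e w y at hwy
  change upperHalf r e x z at hxz
  change upperHalf r e w x
  rcases x with x | i
  · rcases w with w | w
    swap
    · obtain ⟨_, h, -⟩ := low hwx
      simp at h
    rcases y with y | i
    · rcases z with z | j
      · exact up (d := z) hwx hxy hwy hxz (Or.inl ⟨rfl, hyz⟩)
      · obtain ⟨l, hl⟩ := he.inDom j
        exact up (d := y) hwx hxy hwy (r.trans hxz hl) (Or.inr rfl)
    · obtain ⟨j, rfl, hji⟩ := low hyz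
      simp only [upperHalf_iff, Sum.elim_inl, Sum.elim_inr] at hwy hxz ⊢
      obtain ⟨l, hl⟩ := he.inDom i
      -- Here the choice of least representatives in increasing order matters: it puts `e j` before
      -- `w`, so `w` lies between two vertices of the block of `x` while its own block reaches the
      -- lower row of `r`.
      have h1 : e j < w := (he.strictMono hji).trans_le (he.le _ _ (r.symm hwy))
      have := up (d := x) h1 hwx (r.symm hxz) (r.trans hwy hl) (Or.inr rfl)
      exact r.trans (r.symm this) (r.symm hxz)
  · obtain ⟨j, rfl, hji⟩ := low hxy
    obtain ⟨l, rfl, hlj⟩ := low hyz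
    exact absurd (he.eq hxz) (hlj.trans hji).ne'

theorem UpperReps.mem_upperHalf {K : Kind} {r : Setoid (Vertex m n)} {e : Fin q → Fin m}
    (he : UpperReps r e) (h : K.Mem r) : K.Mem (upperHalf r e) := by
  have pb : IsPartialBrauer ⟨m, n, r⟩ → IsPartialBrauer ⟨m, q, upperHalf r e⟩ := by
    rw [isPartialBrauer_iff, isPartialBrauer_iff]
    exact he.atMostPairs
  have b : IsBrauer ⟨m, n, r⟩ → IsBrauer ⟨m, q, upperHalf r e⟩ := by
    rw [isBrauer_iff, isBrauer_iff]
    exact fun h => ⟨he.atMostPairs h.1, he.noSingletons h.2⟩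
  cases K
  exacts [trivial, pb h, b h, he.planar h, ⟨pb h.1, he.planar h.2⟩, ⟨b h.1, he.planar h.2⟩]

end Transversals

/-! ### Full partitions -/

section Full

variable {m n k q p : ℕ}

/-- Each upper vertex lies in a transversal, and no two of them lie in one block. -/
def Full (r : Setoid (Vertex m n)) : Prop :=
  (∀ i j, r (Sum.inl i) (Sum.inl j) → i = j) ∧ ∀ i, InDom r i

theorem UpperReps.full_flip_upperHalf {r : Setoid (Vertex m n)} {e : Fin q → Fin m}
    (he : UpperReps r e) : Full (flip (upperHalf r e)) :=
  ⟨fun _ _ h => he.eq h, fun i => ⟨e i, r.refl _⟩⟩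

/-- Multiplying on the right by a full partition changes neither the kernel nor the domain. -/
theorem Full.upperLe {r : Setoid (Vertex m n)} {s : Setoid (Vertex n k)} (hs : Full s) :
    UpperLe r (comp r s) := by
  refine upperLe_of_eq (fun i i' => ⟨fun h => conn_left h, fun h => ?_⟩) fun i =>
    ⟨fun ⟨j, hj⟩ => ?_, (upperLe_comp r s).inDom⟩
  -- The component of `i` is its `r`-block together with the bottom vertices one `s`-step below it:
  -- a full `s` never joins two distinct middle vertices.
  · let f : Fin m ⊕ (Fin n ⊕ Fin k) → Prop := Sum.elim (fun x => r (Sum.inl i) (Sum.inl x))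
      (Sum.elim (fun j => r (Sum.inl i) (Sum.inr j))
        fun z => ∃ j, r (Sum.inl i) (Sum.inr j) ∧ s (Sum.inl j) (Sum.inr z))
    have mid : ∀ j z, s (Sum.inl j) (Sum.inr z) →
        (r (Sum.inl i) (Sum.inr j) ↔
          ∃ j, r (Sum.inl i) (Sum.inr j) ∧ s (Sum.inl j) (Sum.inr z)) := fun j z h =>
      ⟨fun h' => ⟨j, h', h⟩, fun ⟨j', h', h''⟩ => hs.1 _ _ (s.trans h'' (s.symm h)) ▸ h'⟩
    have : f (Sum.inl i) = f (Sum.inl i') := by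
      refine conn_const f ?_ ?_ h
      · rintro (x | x) (y | y) hxy <;>
          exact propext ⟨fun h' => r.trans h' hxy, fun h' => r.trans h' (r.symm hxy)⟩
      · rintro (x | x) (y | y) hxy
        · rw [hs.1 _ _ hxy]
        · exact propext (mid _ _ hxy)
        · exact propext (mid _ _ (s.symm hxy)).symm
        · exact propext (exists_congr fun j => and_congr_right fun _ =>
            ⟨fun h' => s.trans h' hxy, fun h' => s.trans h' (s.symm hxy)⟩)
    have hi : f (Sum.inl i) := r.refl _
    rw [this] at hi
    exact hi
  · obtain ⟨z, hz⟩ := hs.2 j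
    exact ⟨z, (conn r s).trans (conn_left (x := Sum.inl i) (y := Sum.inr j) hj)
      (conn_right (x := Sum.inl j) (y := Sum.inr z) hz)⟩

theorem Full.comp {r : Setoid (Vertex m n)} {s : Setoid (Vertex n k)} (hr : Full r) (hs : Full s) :
    Full (DiagramCategories.comp r s) :=
  ⟨fun i j h => hr.1 i j (hs.upperLe.1 i j h), fun i => hs.upperLe.inDom (hr.2 i)⟩

/-- The partition of `[q] ∪ [p]'` in which the upper vertex `i` is joined to the lower vertices
`j` with `f j = i`, and the other lower vertices are grouped by their value under `f`. -/
def fibres (q : ℕ) (f : Fin p → ℕ) : Setoid (Vertex q p) :=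
  Setoid.ker (Sum.elim (fun i : Fin q => (i : ℕ)) f)

theorem fibres_iff {f : Fin p → ℕ} {x y : Vertex q p} :
    fibres q f x y ↔ Sum.elim (fun i : Fin q => (i : ℕ)) f x =
      Sum.elim (fun i : Fin q => (i : ℕ)) f y := Iff.rfl

/-- Monotonicity makes the fibres intervals of the lower row, and those joined to upper vertices
come in the same order as these. -/
theorem planar_fibres {f : Fin p → ℕ} (hf : Monotone f) : Planar (fibres q f) := by
  have low : ∀ {i : Fin p} {v : Vertex q p}, boundaryPos (Sum.inr i : Vertex q p) < boundaryPos v →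
      ∃ j, v = Sum.inr j ∧ j < i := by
    rintro i (v | v) h <;> simp only [boundaryPos, Fin.val_rev] at h
    · omega
    · exact ⟨v, rfl, by rw [Fin.lt_def]; omega⟩
  intro w x y z hwx hxy hyz hwy hxz
  rcases y with y | y
  · rcases w with w | w
    · have : (w : ℕ) = y := hwy
      have := hwx.trans hxy
      simp only [boundaryPos] at this
      omega
    · obtain ⟨_, h, -⟩ := low (hwx.trans hxy)
      simp at h
  · obtain ⟨z, rfl, hzy⟩ := low hyz
    have h1 := hf hzy.le
    rcases x with x | x
    · rcases w with w | w
      · have h2 : (w : ℕ) = f y := hwy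
        have h3 : (x : ℕ) = f z := hxz
        simp only [boundaryPos] at hwx
        omega
      · obtain ⟨_, h, -⟩ := low hwx
        simp at h
    · obtain ⟨y, h, hyx⟩ := low hxy
      obtain rfl := Sum.inr_injective h
      have h2 := hf hyx.le
      have h3 : f x = f z := hxz
      exact Eq.trans hwy (show f _ = f x by omega)

theorem full_fibres (hqp : q ≤ p) {f : Fin p → ℕ} (hf : ∀ j : Fin p, (j : ℕ) < q → f j = j) :
    Full (fibres q f) :=
  ⟨fun _ _ h => Fin.ext h, fun i =>
    ⟨⟨i, i.2.trans_le hqp⟩, (hf ⟨i, i.2.trans_le hqp⟩ i.2).symm⟩⟩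

theorem atMostPairs_fibres {f : Fin p → ℕ} (hf : ∀ i j : Fin p, f i = f j → f i < q → i = j)
    (hf' : ∀ i j l, f i = f j → f i = f l → i = j ∨ i = l ∨ j = l) :
    AtMostPairs (fibres q f) := by
  rintro (x | x) (y | y) (z | z) hxy hxz <;>
    simp only [fibres_iff, Sum.elim_inl, Sum.elim_inr] at hxy hxz <;>
    simp only [Sum.inl.injEq, Sum.inr.injEq, reduceCtorEq, false_or, or_false]
  · exact Or.inl (Fin.ext hxy)
  · exact Fin.ext hxy
  · exact Fin.ext hxz
  · exact hf _ _ (hxy.symm.trans hxz) (by omega)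
  · exact Fin.ext (by omega)
  · exact hf _ _ hxz (by omega)
  · exact hf _ _ hxy (by omega)
  · exact hf' _ _ _ hxy hxz

/-- If `q ≤ p` there is a full planar partition from `q` to `p` with blocks of size at most two. -/
theorem exists_full_motzkin (hqp : q ≤ p) : ∃ r : Setoid (Vertex q p), Full r ∧ Planar r ∧
    AtMostPairs r :=
  ⟨fibres q fun j => (j : ℕ), full_fibres hqp fun _ _ => rfl, planar_fibres fun _ _ h => h,
    atMostPairs_fibres (fun _ _ h _ => Fin.ext h) fun _ _ _ h _ => Or.inl (Fin.ext h)⟩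

/-- If `q ≤ p` have the same parity, there is a full planar Brauer partition from `q` to `p`. -/
theorem exists_full_temperleyLieb (hqp : q ≤ p) (hpar : q ≡ p [MOD 2]) :
    ∃ r : Setoid (Vertex q p), Full r ∧ Planar r ∧ AtMostPairs r ∧ NoSingletons r := by
  unfold Nat.ModEq at hpar
  -- The first `q` lower vertices are joined straight up and the other `p - q` are paired
  -- consecutively. Values from `q` on are not labels of upper vertices, so these pairs stay in the
  -- lower row.
  refine ⟨fibres q fun j => if (j : ℕ) < q then (j : ℕ) else q + (j - q) / 2,
    full_fibres hqp fun j hj => if_pos hj, planar_fibres ?_, atMostPairs_fibres ?_ ?_, ?_⟩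
  · intro i j hij
    rw [Fin.le_def] at hij
    dsimp only
    split_ifs <;> omega
  · intro i j h h'
    rw [Fin.ext_iff]
    split_ifs at h h' <;> omega
  · intro i j l h h'
    rw [Fin.ext_iff, Fin.ext_iff, Fin.ext_iff]
    split_ifs at h h' <;> omega
  · rintro (x | x)
    · exact ⟨Sum.inr ⟨x, x.2.trans_le hqp⟩, by simp, by simp [fibres_iff]⟩
    · by_cases hx : (x : ℕ) < q
      · exact ⟨Sum.inl ⟨x, hx⟩, by simp, by simp [fibres_iff, hx]⟩
      · have hxp := x.2
        -- At even offset the partner is the next vertex, which exists because `p - q` is even.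
        by_cases h2 : ((x : ℕ) - q) % 2 = 0
        · refine ⟨Sum.inr ⟨x + 1, by omega⟩, by simp [Fin.ext_iff], ?_⟩
          simp only [fibres_iff, Sum.elim_inr]
          split_ifs <;> omega
        · refine ⟨Sum.inr ⟨x - 1, by omega⟩, by simp [Fin.ext_iff]; omega, ?_⟩
          simp only [fibres_iff, Sum.elim_inr]
          split_ifs <;> omega

end Full

/-! ### Kernel, domain and nontransversals as invariants -/

section Invariants

variable {m n k : ℕ}

/-- The reflection of a diagram in a horizontal line. -/
def Diagram.star (α : Diagram) : Diagram := ⟨α.tgt, α.src, flip α.rel⟩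

theorem exists_block_iff {V : Type*} {r : Setoid V} {v : V} {p : Set V → Prop} :
    (∃ X ∈ r.classes, p X ∧ v ∈ X) ↔ p {y | r y v} := by
  constructor
  · rintro ⟨X, hX, hp, hv⟩
    rwa [Setoid.eq_of_mem_classes hX hv (r.mem_classes v) (r.refl v)] at hp
  · exact fun hp => ⟨_, r.mem_classes v, hp, r.refl v⟩

theorem mem_ker {r : Setoid (Vertex m n)} {i j : Fin m} :
    ((i : ℕ), (j : ℕ)) ∈ ker ⟨m, n, r⟩ ↔ r (Sum.inl i) (Sum.inl j) := by
  constructor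
  · rintro ⟨i', j', h, h'⟩
    rw [Prod.mk.injEq, Fin.val_inj, Fin.val_inj] at h
    rwa [h.1, h.2]
  · exact fun h => ⟨i, j, rfl, h⟩

theorem mem_dom_iff {r : Setoid (Vertex m n)} {x : ℕ} :
    x ∈ dom ⟨m, n, r⟩ ↔ ∃ i : Fin m, x = i ∧ InDom r i := by
  refine exists_congr fun i => and_congr_right fun _ => exists_block_iff.trans ?_
  exact ⟨fun h => h.2.imp fun _ hj => r.symm hj, fun ⟨j, hj⟩ => ⟨⟨i, r.refl _⟩, j, r.symm hj⟩⟩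

theorem mem_upperNontransversals_iff {r : Setoid (Vertex m n)} {A : Set ℕ} :
    A ∈ upperNontransversals ⟨m, n, r⟩ ↔
      ∃ i : Fin m, ¬ InDom r i ∧ A = {y | ((i : ℕ), y) ∈ ker ⟨m, n, r⟩} := by
  have hset : ∀ i : Fin m, {y | ((i : ℕ), y) ∈ ker ⟨m, n, r⟩} =
      {x : ℕ | ∃ j : Fin m, x = j ∧ r (Sum.inl j) (Sum.inl i)} := by
    intro i
    ext y
    constructor
    · rintro ⟨i', j, h, h'⟩
      rw [Prod.mk.injEq, Fin.val_inj] at h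
      exact ⟨j, h.2, by rw [h.1]; exact r.symm h'⟩
    · rintro ⟨j, rfl, h⟩
      exact mem_ker.2 (r.symm h)
  constructor
  · rintro ⟨_, ⟨v | v, rfl⟩, hX, rfl⟩
    · exact ⟨v, fun ⟨j, hj⟩ => hX j (r.symm hj), (hset v).symm⟩
    · exact absurd (r.refl _) (hX v)
  · rintro ⟨i, hi, rfl⟩
    exact ⟨_, r.mem_classes (Sum.inl i), fun j hj => hi ⟨j, r.symm hj⟩, hset i⟩

theorem codom_eq (α : Diagram) : α.codom = α.star.dom := by
  obtain ⟨m, n, r⟩ := α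
  ext x
  refine Iff.trans ?_ mem_dom_iff.symm
  refine exists_congr fun i => and_congr_right fun _ => exists_block_iff.trans ?_
  exact ⟨fun h => h.1.imp fun _ hj => r.symm hj, fun ⟨j, hj⟩ => ⟨⟨j, r.symm hj⟩, i, r.refl _⟩⟩

theorem lowerNontransversals_eq (α : Diagram) :
    α.lowerNontransversals = α.star.upperNontransversals := by
  obtain ⟨m, n, r⟩ := α
  ext A
  constructor
  · rintro ⟨_, ⟨v | v, rfl⟩, hX, rfl⟩
    · exact absurd (r.refl _) (hX v)
    · exact ⟨_, (flip r).mem_classes (Sum.inl v), hX, rfl⟩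
  · rintro ⟨_, ⟨v | v, rfl⟩, hX, rfl⟩
    · exact ⟨_, r.mem_classes (Sum.inr v), hX, rfl⟩
    · exact absurd (r.refl _) (hX v)

/-- The combinatorial description of the preorder `≤_ℛ`. -/
theorem upperLe_iff {r : Setoid (Vertex m n)} {s : Setoid (Vertex m k)} :
    UpperLe r s ↔ ker ⟨m, k, s⟩ ⊆ ker ⟨m, n, r⟩ ∧
      upperNontransversals ⟨m, k, s⟩ ⊆ upperNontransversals ⟨m, n, r⟩ := by
  constructor
  · intro h
    have hker : ker ⟨m, k, s⟩ ⊆ ker ⟨m, n, r⟩ := by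
      rintro _ ⟨i, j, rfl, hij⟩
      exact mem_ker.2 (h.1 i j hij)
    refine ⟨hker, fun A hA => ?_⟩
    obtain ⟨i, hi, rfl⟩ := mem_upperNontransversals_iff.1 hA
    refine mem_upperNontransversals_iff.2 ⟨i, (h.2 i hi).1, Set.Subset.antisymm
      (fun y hy => hker hy) ?_⟩
    rintro y ⟨i', j, hij, h'⟩
    rw [Prod.mk.injEq, Fin.val_inj] at hij
    obtain ⟨rfl, rfl⟩ := hij
    exact mem_ker.2 ((h.2 i hi).2 j h')
  · rintro ⟨hker, hN⟩
    refine ⟨fun i j hij => mem_ker.1 (hker (mem_ker.2 hij)), fun i hi => ?_⟩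
    obtain ⟨i', hi', hA⟩ := mem_upperNontransversals_iff.1
      (hN (mem_upperNontransversals_iff.2 ⟨i, hi, rfl⟩))
    have hmem : ∀ j : Fin m, s (Sum.inl i) (Sum.inl j) ↔ r (Sum.inl i') (Sum.inl j) := by
      intro j
      rw [← mem_ker, ← mem_ker]
      exact Set.ext_iff.1 hA j
    have hii := (hmem i).1 (s.refl _)
    exact ⟨fun h => hi' (h.congr (r.symm hii)), fun j hj => (hmem j).2 (r.trans hii hj)⟩

theorem mem_ker_self {α : Diagram} {x : ℕ} : (x, x) ∈ α.ker ↔ x < α.src := by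
  constructor
  · rintro ⟨i, j, h, -⟩
    rw [Prod.mk.injEq] at h
    rw [h.1]
    exact i.2
  · exact fun h => ⟨⟨x, h⟩, ⟨x, h⟩, rfl, α.rel.refl _⟩

/-- The diagonal of the kernel records the upper row; this is why the description of `ℛ` needs no
condition on `d`. -/
theorem src_eq_of_ker_eq {α β : Diagram} (h : α.ker = β.ker) : α.src = β.src := by
  have key : ∀ x, x < α.src ↔ x < β.src := fun x => by rw [← mem_ker_self, h, mem_ker_self]
  exact le_antisymm (not_lt.1 fun h' => lt_irrefl _ ((key _).1 h'))
    (not_lt.1 fun h' => lt_irrefl _ ((key _).2 h'))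

/-- Together with `upperNontransversals_eq`, this shows that, given the kernel, the domain and the
upper nontransversals determine each other. -/
theorem dom_eq (α : Diagram) :
    α.dom = {x | (x, x) ∈ α.ker ∧ ∀ A ∈ α.upperNontransversals, x ∉ A} := by
  obtain ⟨m, n, r⟩ := α
  ext x
  rw [mem_dom_iff]
  constructor
  · rintro ⟨i, rfl, hi⟩
    refine ⟨mem_ker.2 (r.refl _), fun A hA h => ?_⟩
    obtain ⟨j, hj, rfl⟩ := mem_upperNontransversals_iff.1 hA
    exact hj (hi.congr (r.symm (mem_ker.1 h)))
  · rintro ⟨hx, h⟩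
    refine ⟨⟨x, mem_ker_self.1 hx⟩, rfl, by_contra fun hi => ?_⟩
    exact h _ (mem_upperNontransversals_iff.2 ⟨_, hi, rfl⟩) hx

theorem upperNontransversals_eq (α : Diagram) :
    α.upperNontransversals = {A | ∃ x, (x, x) ∈ α.ker ∧ x ∉ α.dom ∧ A = {y | (x, y) ∈ α.ker}} := by
  obtain ⟨m, n, r⟩ := α
  ext A
  rw [mem_upperNontransversals_iff]
  constructor
  · rintro ⟨i, hi, rfl⟩
    refine ⟨i, mem_ker.2 (r.refl _), fun h => ?_, rfl⟩
    obtain ⟨j, hj, h⟩ := mem_dom_iff.1 h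
    exact hi (by rwa [Fin.ext hj])
  · rintro ⟨x, hx, h, rfl⟩
    exact ⟨⟨x, mem_ker_self.1 hx⟩, fun h' => h (mem_dom_iff.2 ⟨_, rfl, h'⟩), rfl⟩

end Invariants

/-! ### Green's preorders and relations -/

section GreenRelations

variable {K : Kind}

theorem leR_mk {m n k : ℕ} {r : Setoid (Vertex m n)} {s : Setoid (Vertex m k)} (hr : K.Mem r)
    (hs : K.Mem s) (h : UpperLe r s) : LeR (S := K.morphisms) ⟨⟨m, n, r⟩, hr⟩ ⟨⟨m, k, s⟩, hs⟩ :=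
  ⟨⟨⟨k, n, comp (flip s) r⟩, hs.flip.comp hr⟩, rfl,
    congrArg (Diagram.mk m n) (comp_flip_comp h).symm⟩

theorem LeR.description {α β : K.morphisms} (h : LeR α β) :
    α.1.src = β.1.src ∧ β.1.ker ⊆ α.1.ker ∧
      β.1.upperNontransversals ⊆ α.1.upperNontransversals := by
  obtain ⟨⟨m, n, r⟩, hr⟩ := α
  obtain ⟨⟨m', k, s⟩, hs⟩ := β
  obtain ⟨⟨⟨k', l, t⟩, ht⟩, h, e⟩ := h
  obtain rfl : k = k' := h
  obtain rfl : m = m' := congrArg Diagram.src e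
  obtain rfl : n = l := congrArg Diagram.tgt e
  obtain rfl : r = comp s t := by
    have e : Diagram.mk m n r = ⟨m, n, comp s t⟩ := e
    simpa using e
  exact ⟨rfl, upperLe_iff.1 (upperLe_comp s t)⟩

theorem leR_iff {α β : K.morphisms} : LeR α β ↔ α.1.src = β.1.src ∧ β.1.ker ⊆ α.1.ker ∧
    β.1.upperNontransversals ⊆ α.1.upperNontransversals := by
  refine ⟨LeR.description, ?_⟩
  obtain ⟨⟨m, n, r⟩, hr⟩ := α
  obtain ⟨⟨m', k, s⟩, hs⟩ := β
  rintro ⟨h, h'⟩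
  obtain rfl : m = m' := h
  exact leR_mk hr hs (upperLe_iff.2 h')

/-- Reflection, as an operation on each of the six categories. -/
def starMorphism (α : K.morphisms) : K.morphisms := ⟨α.1.star, Kind.Mem.flip α.2⟩

theorem starMorphism_starMorphism (α : K.morphisms) : starMorphism (starMorphism α) = α := by
  obtain ⟨⟨m, n, r⟩, hr⟩ := α
  exact Subtype.ext (congrArg (Diagram.mk m n) (flip_flip r))

theorem star_mul (α β : Diagram) (h : α.tgt = β.src) :
    (α.mul β h).star = β.star.mul α.star h.symm := by
  obtain ⟨m, n, r⟩ := α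
  obtain ⟨n', k, s⟩ := β
  obtain rfl : n = n' := h
  exact congrArg (Diagram.mk k m) (flip_comp r s)

theorem LeL.star {α β : K.morphisms} (h : LeL α β) : LeR (starMorphism α) (starMorphism β) := by
  obtain ⟨γ, h, e⟩ := h
  exact ⟨starMorphism γ, h.symm, (congrArg Diagram.star e).trans (star_mul _ _ h)⟩

theorem LeR.star {α β : K.morphisms} (h : LeR α β) : LeL (starMorphism α) (starMorphism β) := by
  obtain ⟨γ, h, e⟩ := h
  exact ⟨starMorphism γ, h.symm, (congrArg Diagram.star e).trans (star_mul _ _ h)⟩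

theorem leL_iff_leR_star {α β : K.morphisms} :
    LeL α β ↔ LeR (starMorphism α) (starMorphism β) := by
  refine ⟨LeL.star, fun h => ?_⟩
  have := h.star
  rwa [starMorphism_starMorphism, starMorphism_starMorphism] at this

theorem leL_iff {α β : K.morphisms} : LeL α β ↔ α.1.tgt = β.1.tgt ∧ β.1.coker ⊆ α.1.coker ∧
    β.1.lowerNontransversals ⊆ α.1.lowerNontransversals := by
  rw [leL_iff_leR_star, leR_iff, lowerNontransversals_eq, lowerNontransversals_eq]
  rfl

/-- Inclusions are transitive, so associativity of the product is not needed. -/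
theorem LeR.trans {α β γ : K.morphisms} (h : LeR α β) (h' : LeR β γ) : LeR α γ := by
  rw [leR_iff] at *
  exact ⟨h.1.trans h'.1, h'.2.1.trans h.2.1, h'.2.2.trans h.2.2⟩

theorem LeL.trans {α β γ : K.morphisms} (h : LeL α β) (h' : LeL β γ) : LeL α γ := by
  rw [leL_iff_leR_star] at *
  exact LeR.trans h h'

theorem greenR_iff {α β : K.morphisms} : GreenR α β ↔
    α.1.ker = β.1.ker ∧ α.1.upperNontransversals = β.1.upperNontransversals := by
  rw [GreenR, leR_iff, leR_iff]
  constructor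
  · exact fun h => ⟨h.2.2.1.antisymm h.1.2.1, h.2.2.2.antisymm h.1.2.2⟩
  · exact fun h => ⟨⟨src_eq_of_ker_eq h.1, h.1.ge, h.2.ge⟩,
      ⟨(src_eq_of_ker_eq h.1).symm, h.1.le, h.2.le⟩⟩

theorem greenR_iff_dom {α β : K.morphisms} :
    GreenR α β ↔ α.1.dom = β.1.dom ∧ α.1.ker = β.1.ker := by
  rw [greenR_iff]
  constructor
  · rintro ⟨h, h'⟩
    exact ⟨by rw [dom_eq, dom_eq, h, h'], h⟩
  · rintro ⟨h, h'⟩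
    exact ⟨h', by rw [upperNontransversals_eq, upperNontransversals_eq, h, h']⟩

theorem greenL_iff_greenR_star {α β : K.morphisms} :
    GreenL α β ↔ GreenR (starMorphism α) (starMorphism β) :=
  and_congr leL_iff_leR_star leL_iff_leR_star

theorem greenL_iff {α β : K.morphisms} : GreenL α β ↔
    α.1.coker = β.1.coker ∧ α.1.lowerNontransversals = β.1.lowerNontransversals := by
  rw [greenL_iff_greenR_star, greenR_iff, lowerNontransversals_eq, lowerNontransversals_eq]
  rfl

theorem greenL_iff_codom {α β : K.morphisms} :
    GreenL α β ↔ α.1.codom = β.1.codom ∧ α.1.coker = β.1.coker := by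
  rw [greenL_iff_greenR_star, greenR_iff_dom, codom_eq, codom_eq]
  rfl

theorem rank_mul_le_left (α β : Diagram) (h : α.tgt = β.src) : (α.mul β h).rank ≤ α.rank := by
  obtain ⟨m, n, r⟩ := α
  obtain ⟨n', k, s⟩ := β
  obtain rfl : n = n' := h
  exact (upperLe_comp r s).rank_le

theorem rank_star (α : Diagram) : α.star.rank = α.rank := rank_flip α.rel

theorem rank_mul_le_right (α β : Diagram) (h : α.tgt = β.src) : (α.mul β h).rank ≤ β.rank := by
  rw [← rank_star, star_mul, ← rank_star β]
  exact rank_mul_le_left _ _ _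

theorem LeR.rank_le {α β : K.morphisms} (h : LeR α β) : α.1.rank ≤ β.1.rank := by
  obtain ⟨γ, h, e⟩ := h
  rw [e]
  exact rank_mul_le_left _ _ _

theorem LeL.rank_le {α β : K.morphisms} (h : LeL α β) : α.1.rank ≤ β.1.rank := by
  obtain ⟨γ, h, e⟩ := h
  rw [e]
  exact rank_mul_le_right _ _ _

theorem LeJ.rank_le {α β : K.morphisms} (h : LeJ α β) : α.1.rank ≤ β.1.rank := by
  obtain ⟨γ, δ, h, h', e⟩ := h
  rw [e]
  exact (rank_mul_le_left _ _ _).trans (rank_mul_le_right _ _ _)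

/-- In a Brauer diagram the rank has the parity of both rows. With `α = γβδ`, parity passes from `α`
to `γ` through the common upper row and from `γ` to `β` through the row where they are glued. -/
theorem LeJ.rank_modEq {α β : K.morphisms} (hK : K = Kind.B ∨ K = Kind.TL) (h : LeJ α β) :
    α.1.rank ≡ β.1.rank [MOD 2] := by
  have hb : ∀ γ : K.morphisms, γ.1.rank ≡ γ.1.src [MOD 2] := by
    rintro ⟨γ, hγ⟩
    rcases hK with rfl | rfl
    exacts [DiagramCategories.rank_modEq hγ, DiagramCategories.rank_modEq hγ.1]
  have hb' : ∀ γ : K.morphisms, γ.1.rank ≡ γ.1.tgt [MOD 2] := fun γ => by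
    rw [← rank_star]
    exact hb (starMorphism γ)
  obtain ⟨γ, δ, h, h', e⟩ := h
  have hsrc : α.1.src = γ.1.src := by rw [e]; rfl
  refine (hb α).trans ?_
  rw [hsrc]
  refine (hb γ).symm.trans ((hb' γ).trans ?_)
  rw [h]
  exact (hb β).symm

theorem leJ_of_leR_of_leL {α β δ : K.morphisms} (h : LeR α δ) (h' : LeL δ β) : LeJ α β := by
  obtain ⟨γ, h, e⟩ := h
  obtain ⟨γ', h', e'⟩ := h'
  obtain ⟨δ, hδ⟩ := δ
  obtain rfl : δ = γ'.1.mul β.1 h' := e'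
  exact ⟨γ', γ, h', h, e⟩

/-- A full partition between the ranks of two morphisms relates them. -/
theorem leJ_of_full {α β : K.morphisms}
    (h : ∃ r : Setoid (Vertex α.1.rank β.1.rank), Full r ∧ K.Mem r) : LeJ α β := by
  obtain ⟨b, hb, hbK⟩ := h
  obtain ⟨⟨m, n, r⟩, hr⟩ := α
  obtain ⟨⟨l, k, s⟩, hs⟩ := β
  obtain ⟨e, he⟩ := exists_upperReps r
  obtain ⟨e', he'⟩ := exists_upperReps (flip s)
  revert e'
  rw [rank_flip]
  intro e' he'
  -- With `u` the upper half of `α` and `l` the lower half of `β`, the chain is `α ≤_ℛ u(bl) ≤_ℒ bl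
  -- ≤_ℒ l ≤_ℒ β`. Its first step holds because `bl` is full, so that multiplying `u` by it loses no
  -- transversal.
  have hc : Full (comp b (flip (upperHalf (flip s) e'))) := hb.comp he'.full_flip_upperHalf
  have hu : K.Mem (upperHalf r e) := he.mem_upperHalf hr
  have hl : K.Mem (flip (upperHalf (flip s) e')) :=
    (he'.mem_upperHalf (Kind.Mem.flip (r := s) hs)).flip
  have hcK := hbK.comp hl
  have h₁ : LeR (S := K.morphisms) ⟨⟨m, n, r⟩, hr⟩ ⟨⟨m, k, _⟩, hu.comp hcK⟩ :=
    leR_mk hr _ (he.upperLe_upperHalf.trans hc.upperLe)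
  have h₂ : LeL (S := K.morphisms) ⟨⟨m, k, _⟩, hu.comp hcK⟩ ⟨⟨_, k, _⟩, hcK⟩ :=
    ⟨⟨⟨m, _, _⟩, hu⟩, rfl, rfl⟩
  have h₃ : LeL (S := K.morphisms) ⟨⟨_, k, _⟩, hcK⟩ ⟨⟨_, k, _⟩, hl⟩ :=
    ⟨⟨⟨_, _, _⟩, hbK⟩, rfl, rfl⟩
  have h₄ : LeL (S := K.morphisms) ⟨⟨_, k, _⟩, hl⟩ ⟨⟨l, k, s⟩, hs⟩ := by
    rw [leL_iff_leR_star]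
    refine leR_mk (Kind.Mem.flip hl) (Kind.Mem.flip (r := s) hs) ?_
    rw [flip_flip]
    exact he'.upperHalf_upperLe
  exact leJ_of_leR_of_leL h₁ (h₂.trans (h₃.trans h₄))

theorem leJ_iff (hK : K ≠ Kind.B ∧ K ≠ Kind.TL) {α β : K.morphisms} :
    LeJ α β ↔ α.1.rank ≤ β.1.rank := by
  refine ⟨LeJ.rank_le, fun h => leJ_of_full ?_⟩
  obtain ⟨r, hr, hp, hb⟩ := exists_full_motzkin h
  have hb := (isPartialBrauer_iff r).2 hb
  refine ⟨r, hr, ?_⟩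
  cases K
  exacts [trivial, hb, absurd rfl hK.1, hp, ⟨hb, hp⟩, absurd rfl hK.2]

theorem leJ_iff_of_brauer (hK : K = Kind.B ∨ K = Kind.TL) {α β : K.morphisms} :
    LeJ α β ↔ α.1.rank ≤ β.1.rank ∧ α.1.rank ≡ β.1.rank [MOD 2] := by
  refine ⟨fun h => ⟨h.rank_le, h.rank_modEq hK⟩, fun h => leJ_of_full ?_⟩
  obtain ⟨r, hr, hp, hb⟩ := exists_full_temperleyLieb h.1 h.2
  have hb := (isBrauer_iff r).2 hb
  refine ⟨r, hr, ?_⟩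
  rcases hK with rfl | rfl
  exacts [hb, ⟨hb, hp⟩]

theorem greenJ_iff {α β : K.morphisms} : GreenJ α β ↔ α.1.rank = β.1.rank := by
  refine ⟨fun h => le_antisymm h.1.rank_le h.2.rank_le, fun h => ?_⟩
  by_cases hK : K = Kind.B ∨ K = Kind.TL
  · exact ⟨(leJ_iff_of_brauer hK).2 ⟨h.le, by rw [h]⟩, (leJ_iff_of_brauer hK).2 ⟨h.ge, by rw [h]⟩⟩
  · rw [not_or] at hK
    exact ⟨(leJ_iff hK).2 h.le, (leJ_iff hK).2 h.ge⟩

/-- For equal ranks the two upper halves have the same lower row, with trivial cokernel and full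
codomain. They are thus `ℒ`-related to each other, and each is `ℛ`-related to its own morphism. -/
theorem greenD_iff {α β : K.morphisms} : GreenD α β ↔ α.1.rank = β.1.rank := by
  constructor
  · intro h
    refine Relation.EqvGen.rec (motive := fun (α β : K.morphisms) _ => α.1.rank = β.1.rank) ?_
      (fun _ => rfl) (fun _ _ _ h => h.symm) (fun _ _ _ _ _ h h' => h.trans h') h
    rintro α β (h | h)
    exacts [le_antisymm h.1.rank_le h.2.rank_le, le_antisymm h.1.rank_le h.2.rank_le]
  · obtain ⟨⟨m, n, r⟩, hr⟩ := α
    obtain ⟨⟨l, k, s⟩, hs⟩ := β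
    intro h
    obtain ⟨e, he⟩ := exists_upperReps r
    obtain ⟨e', he'⟩ := exists_upperReps s
    have h : rank ⟨m, n, r⟩ = rank ⟨l, k, s⟩ := h
    revert e'
    rw [← h]
    intro e' he'
    have h₁ : GreenR (S := K.morphisms) ⟨⟨m, n, r⟩, hr⟩ ⟨⟨m, _, _⟩, he.mem_upperHalf hr⟩ :=
      ⟨leR_mk _ _ he.upperLe_upperHalf, leR_mk _ _ he.upperHalf_upperLe⟩
    have h₂ : GreenR (S := K.morphisms) ⟨⟨l, _, _⟩, he'.mem_upperHalf hs⟩ ⟨⟨l, k, s⟩, hs⟩ :=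
      ⟨leR_mk _ _ he'.upperHalf_upperLe, leR_mk _ _ he'.upperLe_upperHalf⟩
    have hf := he.full_flip_upperHalf
    have hf' := he'.full_flip_upperHalf
    have hker : ∀ i j, flip (upperHalf r e) (Sum.inl i) (Sum.inl j) ↔
        flip (upperHalf s e') (Sum.inl i) (Sum.inl j) := fun i j =>
      ⟨fun h => hf.1 i j h ▸ (flip (upperHalf s e')).refl _,
        fun h => hf'.1 i j h ▸ (flip (upperHalf r e)).refl _⟩
    have hdom : ∀ i, InDom (flip (upperHalf r e)) i ↔ InDom (flip (upperHalf s e')) i :=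
      fun i => ⟨fun _ => hf'.2 i, fun _ => hf.2 i⟩
    have h₃ : GreenL (S := K.morphisms) ⟨⟨m, _, _⟩, he.mem_upperHalf hr⟩
        ⟨⟨l, _, _⟩, he'.mem_upperHalf hs⟩ := by
      rw [greenL_iff_greenR_star]
      exact ⟨leR_mk (Kind.Mem.flip (he.mem_upperHalf hr)) (Kind.Mem.flip (he'.mem_upperHalf hs))
          (upperLe_of_eq hker hdom),
        leR_mk (Kind.Mem.flip (he'.mem_upperHalf hs)) (Kind.Mem.flip (he.mem_upperHalf hr))
          (upperLe_of_eq (fun i j => (hker i j).symm) fun i => (hdom i).symm)⟩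
    exact .trans _ _ _ (.rel _ _ (Or.inl h₁))
      (.trans _ _ _ (.rel _ _ (Or.inr h₃)) (.rel _ _ (Or.inl h₂)))

end GreenRelations

end DiagramCategories

theorem mainTheorem10 (K : DiagramCategories.Kind) (α β : K.morphisms) :
    -- description of the preorder `≤_ℛ`
    (DiagramCategories.LeR α β ↔
      α.1.src = β.1.src ∧ β.1.ker ⊆ α.1.ker ∧
        β.1.upperNontransversals ⊆ α.1.upperNontransversals) ∧
    -- description of the preorder `≤_ℒ`
    (DiagramCategories.LeL α β ↔
      α.1.tgt = β.1.tgt ∧ β.1.coker ⊆ α.1.coker ∧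
        β.1.lowerNontransversals ⊆ α.1.lowerNontransversals) ∧
    -- description of the preorder `≤_𝒥`
    (K ≠ DiagramCategories.Kind.B ∧ K ≠ DiagramCategories.Kind.TL →
      (DiagramCategories.LeJ α β ↔ α.1.rank ≤ β.1.rank)) ∧
    (K = DiagramCategories.Kind.B ∨ K = DiagramCategories.Kind.TL →
      (DiagramCategories.LeJ α β ↔ α.1.rank ≤ β.1.rank ∧ α.1.rank ≡ β.1.rank [MOD 2])) ∧
    -- the relation `ℛ`
    (DiagramCategories.GreenR α β ↔
      α.1.ker = β.1.ker ∧ α.1.upperNontransversals = β.1.upperNontransversals) ∧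
    (DiagramCategories.GreenR α β ↔ α.1.dom = β.1.dom ∧ α.1.ker = β.1.ker) ∧
    -- the relation `ℒ`
    (DiagramCategories.GreenL α β ↔
      α.1.coker = β.1.coker ∧ α.1.lowerNontransversals = β.1.lowerNontransversals) ∧
    (DiagramCategories.GreenL α β ↔ α.1.codom = β.1.codom ∧ α.1.coker = β.1.coker) ∧
    -- the relations `𝒥` and `𝒟`
    (DiagramCategories.GreenJ α β ↔ DiagramCategories.GreenD α β) ∧
    (DiagramCategories.GreenD α β ↔ α.1.rank = β.1.rank) := by
  exact ⟨DiagramCategories.leR_iff, DiagramCategories.leL_iff,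
    fun hK => DiagramCategories.leJ_iff hK, fun hK => DiagramCategories.leJ_iff_of_brauer hK,
    DiagramCategories.greenR_iff, DiagramCategories.greenR_iff_dom, DiagramCategories.greenL_iff,
    DiagramCategories.greenL_iff_codom,
    DiagramCategories.greenJ_iff.trans DiagramCategories.greenD_iff.symm,
    DiagramCategories.greenD_iff⟩
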